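/- Let $\Sigma=(V,E,\sigma)$ be a finite signed graph (loops and multiple edges allowed, $\sigma:E\to\{1,-1\}$) with an orientation $\varepsilon$, i.e. an arrow $\varepsilon(v,e)=\pm1$ at each end of each edge with $\varepsilon(u,e)\varepsilon(v,e)=-\sigma(e)$ for $e=uv$ (a positive loop carries both a $+1$ and a $-1$ at its vertex). *Flows.* An integral flow is an $f:E\to\mathbb Z$ such that at every vertex $v$ the sum of $\varepsilon(v,e)f(e)$ over all edge-ends at $v$ is $0$. It is elementary if it is nonzero, is not a sum $f_1+f_2$ of nonzero integral flows with $f_1(e)f_2(e)\ge 0$ for all $e$, and no nonzero integral flow has support properly contained in $\operatorname{supp} f$. *Walks.* Let $W=u_0x_1u_1\cdots x_nu_n$ be a walk with $n\ge1$. A direction $\varepsilon_W$ of $W$ assigns $\pm1$ to the pairs $(u_{i-1},x_i)$ and $(u_i,x_i)$ so that $\varepsilon_W(u_{i-1},x_i)\varepsilon_W(u_i,x_i)=-\sigma(x_i)$ and $\varepsilon_W(u_i,x_i)+\varepsilon_W(u_i,x_{i+1})=0$. The walk $W$ is Eulerian if $u_0=u_n$, $\prod_i\sigma(x_i)=1$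 and its directions agree on repeated occurrences of the same edge; minimal if it is Eulerian and no Eulerian walk is properly contained in it as an edge multiset; elementary if it is minimal and no minimal Eulerian walk has support properly contained in $\operatorname{supp}W$. The characteristic vector of $(W,\varepsilon_W)$ is $f_{(W,\varepsilon_W)}(x)=\sum_{i:\,x_i=x}\varepsilon(u_{i-1},x_i)\,\varepsilon_W(u_{i-1},x_i)$, and $\Sigma(W)$ is the subgraph formed by the edges of $W$ and their end-vertices. *Cycle-trees.* A cycle is a simple closed path, balanced if the product of its signs is $1$ and unbalanced otherwise. A cycle-tree is a connected subgraph $T$ with at least one edge that decomposes into edge-disjoint cycles $C_i$ and vertex-disjoint simple paths $P_j$ of positive length (edge-disjoint from the cycles) such that: $\{C_i\}$ is the set of all cycles of $T$; two cycles share at most one vertex; each $P_j$ meets exactly two cycles, one exactly in the initial and the other exactly in the terminal vertex of $P_j$; and every intersection vertex (a common vertex of two cycles, or of a cycle and some $P_j$) is a cut-point of $T$, that is, a separating vertex: $T$ decomposes into two subgraphs, each with at least one edge, having just this vertex in common. It is Eulerian if every balanced cycle of $T$ contains an even, and every unbalanced cycle an odd, number of intersection vertices. A circuit is an Eulerian cycle-tree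 that properly contains no Eulerian cycle-tree. **Corollary (Characterization and Classification of Circuits).** 1. Let $W$ be a minimal Eulerian walk with a direction $\varepsilon_W$. The following are equivalent: (a) $W$ is elementary; (b) $f_{(W,\varepsilon_W)}$ is an elementary flow; (c) $\Sigma(W)$ is a circuit. 2. A subgraph (given by a set of edges and their end-vertices) is a circuit if and only if it is of one of the following types. Type I: a single balanced cycle. Type II: the union of two edge-disjoint unbalanced cycles having a single common vertex. Type III: the union of two vertex-disjoint unbalanced cycles $C_1,C_2$ and a simple path $P$ of positive length such that $C_1\cap P$ is exactly the initial and $C_2\cap P$ exactly the terminal vertex of $P$. 3. There is a unique matroid on $E$ whose circuits are exactly the edge sets of Types I, II and III (Zaslavsky's signed-graphic matroid), and it is the same as the matroid on $E$ whose circuits are exactly the supports of the elementary integral flows of $(\Sigma,\varepsilon)$. -/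

import Mathlib

/-- A signed graph on the vertex set `V` and the edge set `E`, loops and multiple edges allowed.
Every edge `e` has two ends (half-edges) `(e, false)` and `(e, true)`, lying at the vertices
`ends e false` and `ends e true`; the edge is a loop when these vertices coincide. -/
structure SignedGraph (V E : Type*) where
  ends : E → Bool → V
  sign : E → ℤˣ

namespace SignedGraph

variable {V E : Type*}

/-! ### Orientations and integral flows -/

/-- An orientation: an arrow at each end of each edge, `1` if it points away from the vertex and
`-1` if it points toward the vertex, such that `ε(u,e) ε(v,e) = -σ(e)` for `e = uv`. Arrows are
attached to half-edges, so that a positive loop carries both a `1` and a `-1`. -/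
structure Orientation (G : SignedGraph V E) where
  arrow : E → Bool → ℤˣ
  arrow_mul : ∀ e, arrow e false * arrow e true = -G.sign e

/-- The incidence number `m_{v,e}`: the sum of the arrows at the ends of `e` that lie at `v`. -/
def incidence (G : SignedGraph V E) [DecidableEq V] (ε : G.Orientation) (v : V) (e : E) : ℤ :=
  ∑ b : Bool, if G.ends e b = v then (ε.arrow e b : ℤ) else 0

/-- `f` is an integral flow: its boundary vanishes at every vertex. -/
def IsFlow (G : SignedGraph V E) [DecidableEq V] [Fintype E] (ε : G.Orientation)
    (f : E → ℤ) : Prop :=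
  ∀ v, ∑ e, G.incidence ε v e * f e = 0

/-- The support of an integral function on the edges. -/
def flowSupp [Fintype E] (f : E → ℤ) : Finset E :=
  Finset.univ.filter fun e => f e ≠ 0

/-- `f` is the sum of two nontrivial integral flows that have the same sign at every edge. -/
def IsDecomposable (G : SignedGraph V E) [DecidableEq V] [Fintype E] (ε : G.Orientation)
    (f : E → ℤ) : Prop :=
  ∃ f₁ f₂ : E → ℤ, G.IsFlow ε f₁ ∧ G.IsFlow ε f₂ ∧ f₁ ≠ 0 ∧ f₂ ≠ 0 ∧
    (∀ e, 0 ≤ f₁ e * f₂ e) ∧ f = f₁ + f₂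

/-- Nontrivial integral flows that are not decomposable. -/
def IsIndecomposableFlow (G : SignedGraph V E) [DecidableEq V] [Fintype E] (ε : G.Orientation)
    (f : E → ℤ) : Prop :=
  G.IsFlow ε f ∧ f ≠ 0 ∧ ¬ G.IsDecomposable ε f

/-- Elementary flows: indecomposable, and no nontrivial integral flow has a strictly smaller
support. -/
def IsElementaryFlow (G : SignedGraph V E) [DecidableEq V] [Fintype E] (ε : G.Orientation)
    (f : E → ℤ) : Prop :=
  G.IsIndecomposableFlow ε f ∧ ¬ ∃ g : E → ℤ, G.IsFlow ε g ∧ g ≠ 0 ∧ flowSupp g ⊂ flowSupp f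

/-! ### Walks -/

/-- A walk `u₀ x₁ u₁ x₂ … xₙ uₙ` of length `n ≥ 1`. With indices shifted to start at `0`, the step
`i` traverses the edge `edge i` from its end `side i` to its other end `!side i`. -/
structure Walk (G : SignedGraph V E) where
  length : ℕ
  length_pos : 0 < length
  edge : Fin length → E
  side : Fin length → Bool
  chain : ∀ i j : Fin length, j.val = i.val + 1 →
    G.ends (edge i) (!side i) = G.ends (edge j) (side j)

namespace Walk

variable {G : SignedGraph V E}

/-- The vertex from which step `i` departs. -/
def tail (W : G.Walk) (i : Fin W.length) : V := G.ends (W.edge i) (W.side i)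

/-- The vertex at which step `i` arrives. -/
def head (W : G.Walk) (i : Fin W.length) : V := G.ends (W.edge i) (!W.side i)

/-- The index of the first step. -/
def first (W : G.Walk) : Fin W.length := ⟨0, W.length_pos⟩

/-- The index of the last step. -/
def last (W : G.Walk) : Fin W.length := ⟨W.length - 1, Nat.sub_lt W.length_pos Nat.one_pos⟩

/-- The terminal vertex is the initial vertex. -/
def IsClosed (W : G.Walk) : Prop := W.head W.last = W.tail W.first

/-- The sign of a walk. -/
def sign (W : G.Walk) : ℤˣ := ∏ i, G.sign (W.edge i)

/-- The multiset of the edges of a walk. -/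
def edges (W : G.Walk) : Multiset E := Finset.univ.val.map W.edge

/-- The set of the edges of a walk. -/
def supp [DecidableEq E] (W : G.Walk) : Finset E := Finset.univ.image W.edge

/-- A direction of a walk: `arrow i b` is the arrow at the end `b` of the edge of step `i`. -/
structure Direction (W : G.Walk) where
  arrow : Fin W.length → Bool → ℤˣ
  arrow_mul : ∀ i, arrow i (W.side i) * arrow i (!W.side i) = -G.sign (W.edge i)
  arrow_chain : ∀ i j : Fin W.length, j.val = i.val + 1 →
    (arrow i (!W.side i) : ℤ) + (arrow j (W.side j) : ℤ) = 0

/-- Eulerian walks: balanced closed walks whose directions have the same orientation on repeated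
edges. -/
def IsEulerian (W : G.Walk) : Prop :=
  W.IsClosed ∧ W.sign = 1 ∧
    ∀ D : W.Direction, ∀ i j, W.edge i = W.edge j → D.arrow i = D.arrow j

/-- No Eulerian walk is properly contained in `W` as an edge multiset. -/
def IsMinimalEulerian (W : G.Walk) : Prop :=
  W.IsEulerian ∧ ¬ ∃ W' : G.Walk, W'.IsEulerian ∧ W'.edges < W.edges

/-- Elementary Eulerian walks: minimal, and no minimal Eulerian walk has a strictly smaller
support. -/
def IsElementary [DecidableEq E] (W : G.Walk) : Prop :=
  W.IsMinimalEulerian ∧ ¬ ∃ W' : G.Walk, W'.IsMinimalEulerian ∧ W'.supp ⊂ W.supp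

/-- The characteristic vector of a walk `W` with direction `D`: the value at the edge `x` is the sum
of the couplings `[ε, ε_W](x_i)` over the steps with `x_i = x`. -/
def charVector [DecidableEq E] (W : G.Walk) (ε : G.Orientation) (D : W.Direction) (x : E) : ℤ :=
  ∑ i, if W.edge i = x then (ε.arrow (W.edge i) (W.side i) * D.arrow i (W.side i) : ℤ) else 0

/-- A simple closed path. -/
def IsSimpleClosed (W : G.Walk) : Prop :=
  W.IsClosed ∧ Function.Injective W.tail ∧ Function.Injective W.edge

/-- A simple path: the vertices `u₀, …, uₙ` are distinct. -/
def IsSimplePath (W : G.Walk) : Prop :=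
  Function.Injective W.tail ∧ ∀ i, W.tail i ≠ W.head W.last

end Walk

/-! ### Subgraphs given by edge sets -/

/-- The vertices of the subgraph `Σ(S)` formed by the edges in `S` and their ends. -/
def verts (G : SignedGraph V E) (S : Finset E) : Set V := {v | ∃ e ∈ S, ∃ b, G.ends e b = v}

/-- `S` has an edge, and any two vertices of `Σ(S)` can be joined inside `Σ(S)`. -/
def IsConnected (G : SignedGraph V E) (S : Finset E) : Prop :=
  S.Nonempty ∧ ∀ u ∈ G.verts S, ∀ v ∈ G.verts S,
    Relation.ReflTransGen (fun a b => ∃ e ∈ S, ∃ s, G.ends e s = a ∧ G.ends e (!s) = b) u v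

/-- `v` is a cut-point (separating vertex) of the connected subgraph `Σ(S)`: the subgraph
decomposes into two parts, each having an edge, with exactly the vertex `v` in common.
Equivalently, `Σ(S)` as a topological space falls apart when the point `v` is removed. -/
def IsCutPoint (G : SignedGraph V E) [DecidableEq E] (S : Finset E) (v : V) : Prop :=
  ∃ A B : Finset E, A.Nonempty ∧ B.Nonempty ∧ Disjoint A B ∧ A ∪ B = S ∧
    G.verts A ∩ G.verts B = {v}

/-- `C` is the edge set of a cycle. -/
def IsCycle (G : SignedGraph V E) [DecidableEq E] (C : Finset E) : Prop :=
  ∃ W : G.Walk, W.IsSimpleClosed ∧ W.supp = C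

/-- A set of edges (a cycle) is balanced if the product of the signs is positive. -/
def IsBalanced (G : SignedGraph V E) (C : Finset E) : Prop := ∏ e ∈ C, G.sign e = 1

/-- A balanced cycle. -/
def IsBalancedCycle (G : SignedGraph V E) [DecidableEq E] (C : Finset E) : Prop :=
  G.IsCycle C ∧ G.IsBalanced C

/-- An unbalanced cycle. -/
def IsUnbalancedCycle (G : SignedGraph V E) [DecidableEq E] (C : Finset E) : Prop :=
  G.IsCycle C ∧ ¬ G.IsBalanced C

/-- `P` is the edge set of a simple path of positive length from `a` to `b`. -/
def IsPath (G : SignedGraph V E) [DecidableEq E] (P : Finset E) (a b : V) : Prop :=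
  ∃ W : G.Walk, W.IsSimplePath ∧ W.supp = P ∧ W.tail W.first = a ∧ W.head W.last = b

/-! ### Cycle-trees and circuits -/

/-- The intersection vertices of a cycle-tree `T` with block paths `Ps`: the common vertices of two
cycles in `T`, and the common vertices of a cycle in `T` and a block path. -/
def IsIntersectionVertex (G : SignedGraph V E) [DecidableEq E] (T : Finset E)
    (Ps : Finset (Finset E)) (v : V) : Prop :=
  (∃ C C' : Finset E, C ⊆ T ∧ C' ⊆ T ∧ G.IsCycle C ∧ G.IsCycle C' ∧ C ≠ C' ∧
    v ∈ G.verts C ∧ v ∈ G.verts C') ∨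
  (∃ C : Finset E, ∃ P ∈ Ps, C ⊆ T ∧ G.IsCycle C ∧ v ∈ G.verts C ∧ v ∈ G.verts P)

/-- The subgraph with edge set `T` is a cycle-tree with block paths (of positive length) `Ps`; its
block cycles are all the cycles contained in `T`. Block paths of length zero contribute nothing to
a decomposition, so they are not listed. -/
structure IsCycleTreeWith (G : SignedGraph V E) [DecidableEq E] (T : Finset E)
    (Ps : Finset (Finset E)) : Prop where
  connected : G.IsConnected T
  /-- `T` is the union of its cycles and of the block paths. -/
  cover : ∀ e, e ∈ T ↔ (∃ C, C ⊆ T ∧ G.IsCycle C ∧ e ∈ C) ∨ ∃ P ∈ Ps, e ∈ P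
  cycles_disjoint : ∀ C C', C ⊆ T → C' ⊆ T → G.IsCycle C → G.IsCycle C' → C ≠ C' → Disjoint C C'
  cycle_path_disjoint : ∀ C, C ⊆ T → G.IsCycle C → ∀ P ∈ Ps, Disjoint C P
  paths_disjoint : ∀ P ∈ Ps, ∀ P' ∈ Ps, P ≠ P' → Disjoint (G.verts P) (G.verts P')
  /-- Two cycles meet in the empty set or in a single vertex. -/
  cycles_inter : ∀ C C', C ⊆ T → C' ⊆ T → G.IsCycle C → G.IsCycle C' → C ≠ C' →
    (G.verts C ∩ G.verts C').Subsingleton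
  /-- Each block path meets exactly two cycles, one in its initial vertex and one in its terminal
  vertex. -/
  paths_inter : ∀ P ∈ Ps, ∃ a b, G.IsPath P a b ∧ ∃ C C', C ⊆ T ∧ C' ⊆ T ∧
    G.IsCycle C ∧ G.IsCycle C' ∧ C ≠ C' ∧
    G.verts C ∩ G.verts P = {a} ∧ G.verts C' ∩ G.verts P = {b} ∧
    ∀ C'', C'' ⊆ T → G.IsCycle C'' → C'' ≠ C → C'' ≠ C' → Disjoint (G.verts C'') (G.verts P)
  cutPoint : ∀ v, G.IsIntersectionVertex T Ps v → G.IsCutPoint T v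

/-- Eulerian cycle-trees: cycle-trees in which each balanced cycle has an even number, and each
unbalanced cycle an odd number, of intersection vertices. -/
def IsEulerianCycleTree (G : SignedGraph V E) [DecidableEq E] (T : Finset E) : Prop :=
  ∃ Ps : Finset (Finset E), G.IsCycleTreeWith T Ps ∧ ∀ C, C ⊆ T → G.IsCycle C →
    (G.IsBalanced C → Even {v | v ∈ G.verts C ∧ G.IsIntersectionVertex T Ps v}.ncard) ∧
    (¬ G.IsBalanced C → Odd {v | v ∈ G.verts C ∧ G.IsIntersectionVertex T Ps v}.ncard)

/-- Circuits: Eulerian cycle-trees that do not properly contain an Eulerian cycle-tree. -/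
def IsCircuit (G : SignedGraph V E) [DecidableEq E] (T : Finset E) : Prop :=
  G.IsEulerianCycleTree T ∧ ¬ ∃ T', T' ⊂ T ∧ G.IsEulerianCycleTree T'

/-- Type I: a single balanced cycle. -/
def IsTypeI (G : SignedGraph V E) [DecidableEq E] (T : Finset E) : Prop := G.IsBalancedCycle T

/-- Type II: two edge-disjoint unbalanced cycles with a single common vertex. -/
def IsTypeII (G : SignedGraph V E) [DecidableEq E] (T : Finset E) : Prop :=
  ∃ C₁ C₂ : Finset E, G.IsUnbalancedCycle C₁ ∧ G.IsUnbalancedCycle C₂ ∧ Disjoint C₁ C₂ ∧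
    (∃ v, G.verts C₁ ∩ G.verts C₂ = {v}) ∧ T = C₁ ∪ C₂

/-- Type III: two vertex-disjoint unbalanced cycles and a simple path of positive length that meets
the first cycle exactly in its initial and the second exactly in its terminal vertex. -/
def IsTypeIII (G : SignedGraph V E) [DecidableEq E] (T : Finset E) : Prop :=
  ∃ C₁ C₂ P : Finset E, ∃ a b : V, G.IsUnbalancedCycle C₁ ∧ G.IsUnbalancedCycle C₂ ∧
    Disjoint (G.verts C₁) (G.verts C₂) ∧ G.IsPath P a b ∧
    G.verts C₁ ∩ G.verts P = {a} ∧ G.verts C₂ ∩ G.verts P = {b} ∧ T = C₁ ∪ P ∪ C₂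

/-- `M` is Zaslavsky's signed-graphic matroid: the matroid on the edge set whose circuits are
exactly the edge sets of Types I, II and III. -/
def IsSignedGraphicMatroid (G : SignedGraph V E) [DecidableEq E] (M : Matroid E) : Prop :=
  M.E = Set.univ ∧
    ∀ C : Finset E, M.IsCircuit (C : Set E) ↔ G.IsTypeI C ∨ G.IsTypeII C ∨ G.IsTypeIII C

/-- `M` is the matroid on the edge set whose circuits are exactly the supports of the elementary
flows. -/
def IsElementaryFlowMatroid (G : SignedGraph V E) [DecidableEq V] [Fintype E] (ε : G.Orientation)
    (M : Matroid E) : Prop :=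
  M.E = Set.univ ∧
    ∀ C : Finset E, M.IsCircuit (C : Set E) ↔ ∃ f : E → ℤ, G.IsElementaryFlow ε f ∧ flowSupp f = C

end SignedGraph

/-! Everything reduces to one statement, `isTyped_iff_minimal_flowSupp`: the edge sets of Types I,
II and III are exactly the inclusion-minimal supports of nonzero integral flows.

One unit sent round a closed walk based at `v` leaves net flow 0 at `v` if the walk is balanced and
±2 if it is not. So a balanced cycle carries a flow, and two unbalanced cycles cancel each other's
±2, directly or along a path carrying 2 (`IsTyped.exists_isFlow`). Conversely, the support of a flow
has no vertex with a single edge-end. If it contains no balanced cycle, it contains an unbalanced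
cycle that it leaves by some further edge. A walk continued from there without backtracking yields
Type II, Type III, or a theta graph, which carries a flow of smaller support
(`IsFlow.exists_isTyped`). No typed set properly contains another (`IsTyped.eq_of_subset`), because
the leafless subsets of a typed set can be listed.

Circuits: typed sets are Eulerian cycle-trees, and parity forces every Eulerian cycle-tree to
contain a typed set, so the minimal ones are the typed sets.

Walks: the characteristic vector of an Eulerian walk is a flow whose absolute values are the edge
multiplicities, and below the absolute value of any nonzero flow an Eulerian walk can be traced
greedily (`IsFlow.exists_isEulerian`). Hence minimal walks give indecomposable flows, and minimality
of supports means the same for walks and for flows.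

Matroid: the columns of the incidence matrix define a linear matroid over `ℚ`. Denominators can be
cleared, so its circuits are the minimal supports of nonzero integral flows. -/

namespace SignedGraph

variable {V E : Type*} {G : SignedGraph V E}

/-! ### Walks as lists of darts -/

/-- The vertex from which the dart `d`, an edge traversed from its end `d.2`, departs. -/
def dtail (G : SignedGraph V E) (d : E × Bool) : V := G.ends d.1 d.2

/-- The vertex at which a dart arrives. -/
def dhead (G : SignedGraph V E) (d : E × Bool) : V := G.ends d.1 (!d.2)

/-- The same edge traversed in the other direction. -/
def dflip (d : E × Bool) : E × Bool := (d.1, !d.2)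

@[simp] theorem dtail_dflip (d : E × Bool) : G.dtail (dflip d) = G.dhead d := rfl

@[simp] theorem dhead_dflip (d : E × Bool) : G.dhead (dflip d) = G.dtail d := by
  simp [dhead, dflip, dtail]

@[simp] theorem dflip_dflip (d : E × Bool) : dflip (dflip d) = d := by
  simp [dflip]

theorem dflip_ne (d : E × Bool) : dflip d ≠ d := by
  rcases d with ⟨e, b⟩
  cases b <;> simp [dflip]

theorem eq_or_eq_dflip {d d' : E × Bool} (h : d.1 = d'.1) : d = d' ∨ d = dflip d' := by
  rcases d with ⟨e, b⟩
  rcases d' with ⟨e', b'⟩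
  obtain rfl : e = e' := h
  cases b <;> cases b' <;> simp [dflip]

/-- The list of darts `l` is a walk from `u` to `w`. -/
def IsDartWalk (G : SignedGraph V E) : V → List (E × Bool) → V → Prop
  | u, [], w => u = w
  | u, d :: l, w => G.dtail d = u ∧ G.IsDartWalk (G.dhead d) l w

@[simp] theorem isDartWalk_nil {u w : V} : G.IsDartWalk u [] w ↔ u = w := Iff.rfl

@[simp] theorem isDartWalk_cons {u w : V} {d : E × Bool} {l : List (E × Bool)} :
    G.IsDartWalk u (d :: l) w ↔ G.dtail d = u ∧ G.IsDartWalk (G.dhead d) l w := Iff.rfl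

theorem isDartWalk_append {l l' : List (E × Bool)} {u w : V} :
    G.IsDartWalk u (l ++ l') w ↔ ∃ v, G.IsDartWalk u l v ∧ G.IsDartWalk v l' w := by
  induction l generalizing u with
  | nil => simp
  | cons d l ih => simp [ih, and_assoc]

/-- Both sides are the vertex sequence of the walk. The comparisons below between departure and
arrival vertices rest on this identity. -/
theorem IsDartWalk.map_dtail_append {l : List (E × Bool)} {u w : V} (h : G.IsDartWalk u l w) :
    l.map G.dtail ++ [w] = u :: l.map G.dhead := by
  induction l generalizing u with
  | nil => simpa using h.symm
  | cons d l ih => simp [h.1, ih h.2]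

theorem IsDartWalk.dtail_head {l : List (E × Bool)} {u w : V} (h : G.IsDartWalk u l w)
    (hl : l ≠ []) : G.dtail (l.head hl) = u := by
  cases l with
  | nil => exact absurd rfl hl
  | cons d l => exact h.1

theorem IsDartWalk.dhead_getLast {l : List (E × Bool)} {u w : V} (h : G.IsDartWalk u l w)
    (hl : l ≠ []) : G.dhead (l.getLast hl) = w := by
  induction l generalizing u with
  | nil => exact absurd rfl hl
  | cons d l ih =>
    cases l with
    | nil => exact h.2
    | cons d' l => simpa using ih h.2 (by simp)

theorem IsDartWalk.isChain {l : List (E × Bool)} {u w : V} (h : G.IsDartWalk u l w) :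
    l.IsChain fun d d' => G.dhead d = G.dtail d' := by
  induction l generalizing u with
  | nil => simp
  | cons d l ih =>
    cases l with
    | nil => simp
    | cons d' l => exact List.isChain_cons_cons.2 ⟨h.2.1.symm, ih h.2⟩

theorem isDartWalk_of_isChain {l : List (E × Bool)} (hl : l ≠ [])
    (h : l.IsChain fun d d' => G.dhead d = G.dtail d') :
    G.IsDartWalk (G.dtail (l.head hl)) l (G.dhead (l.getLast hl)) := by
  induction l with
  | nil => exact absurd rfl hl
  | cons d l ih =>
    cases l with
    | nil => simp
    | cons d' l =>
      rw [List.isChain_cons_cons] at h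
      have := ih (by simp) h.2
      simp only [List.head_cons] at this
      refine ⟨rfl, ?_⟩
      rw [h.1]
      simpa using this

namespace Walk

/-- The darts traversed by a walk. -/
def darts (W : G.Walk) : List (E × Bool) := List.ofFn fun i => (W.edge i, W.side i)

theorem darts_ne_nil (W : G.Walk) : W.darts ≠ [] := by
  simp [darts, List.ofFn_eq_nil_iff, W.length_pos.ne']

theorem isDartWalk_darts (W : G.Walk) :
    G.IsDartWalk (W.tail W.first) W.darts (W.head W.last) := by
  have h := isDartWalk_of_isChain (G := G) W.darts_ne_nil (by
    rw [List.isChain_iff_getElem]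
    intro i hi
    simp only [darts, List.getElem_ofFn]
    exact W.chain _ _ rfl)
  convert h using 1
  · simp [darts, List.head_ofFn, tail, dtail, first]
  · simp [darts, List.getLast_ofFn, head, dhead, last]

/-- The walk with a given list of darts. -/
def ofDarts (l : List (E × Bool)) (hl : l ≠ [])
    (h : l.IsChain fun d d' => G.dhead d = G.dtail d') : G.Walk where
  length := l.length
  length_pos := List.length_pos_iff.2 hl
  edge i := (l[i]).1
  side i := (l[i]).2
  chain i j hij := by
    have := (List.isChain_iff_getElem.1 h) i (by omega)
    simp only [Fin.getElem_fin, hij]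
    exact this

@[simp] theorem darts_ofDarts (l : List (E × Bool)) (hl : l ≠ [])
    (h : l.IsChain fun d d' => G.dhead d = G.dtail d') : (ofDarts l hl h).darts = l := by
  simp only [darts, ofDarts]
  exact List.ofFn_getElem

theorem edges_eq (W : G.Walk) : W.edges = (W.darts.map Prod.fst : List E) := by
  rw [edges, darts, List.map_ofFn]
  rw [← Fin.univ_val_map]
  rfl

theorem sign_eq (W : G.Walk) : W.sign = (W.darts.map fun d => G.sign d.1).prod := by
  rw [sign, darts, List.map_ofFn, List.prod_ofFn]
  rfl

theorem supp_eq [DecidableEq E] (W : G.Walk) : W.supp = (W.darts.map Prod.fst).toFinset := by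
  ext e
  simp [supp, darts, List.mem_ofFn]

theorem nodup_map_dtail (W : G.Walk) : (W.darts.map G.dtail).Nodup ↔ Function.Injective W.tail := by
  rw [darts, List.map_ofFn, List.nodup_ofFn]
  rfl

theorem nodup_map_fst (W : G.Walk) : (W.darts.map Prod.fst).Nodup ↔ Function.Injective W.edge := by
  rw [darts, List.map_ofFn, List.nodup_ofFn]
  rfl

theorem mem_map_dtail (W : G.Walk) (v : V) : v ∈ W.darts.map G.dtail ↔ ∃ i, W.tail i = v := by
  simp [darts, List.mem_ofFn, dtail, tail]

end Walk

/-- The set of edges of a list of darts. -/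
def dedges [DecidableEq E] (l : List (E × Bool)) : Finset E := (l.map Prod.fst).toFinset

/-- `l` is a simple closed path based at `u`. -/
structure IsDartCycle (G : SignedGraph V E) (u : V) (l : List (E × Bool)) : Prop where
  ne_nil : l ≠ []
  walk : G.IsDartWalk u l u
  tails : (l.map G.dtail).Nodup
  edges : (l.map Prod.fst).Nodup

/-- `l` is a simple path from `u` to `w`. -/
structure IsDartPath (G : SignedGraph V E) (u : V) (l : List (E × Bool)) (w : V) : Prop where
  ne_nil : l ≠ []
  walk : G.IsDartWalk u l w
  tails : (l.map G.dtail).Nodup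
  notMem : w ∉ l.map G.dtail

/-- Passes from walks indexed by `Fin` to lists, which can be split, rotated and extended. -/
theorem isCycle_iff [DecidableEq E] {C : Finset E} :
    G.IsCycle C ↔ ∃ u l, G.IsDartCycle u l ∧ dedges l = C := by
  constructor
  · rintro ⟨W, ⟨hc, ht, he⟩, rfl⟩
    have hw := W.isDartWalk_darts
    rw [hc] at hw
    exact ⟨_, W.darts, ⟨W.darts_ne_nil, hw, W.nodup_map_dtail.2 ht, W.nodup_map_fst.2 he⟩,
      W.supp_eq.symm⟩
  · rintro ⟨u, l, ⟨hl, hw, ht, he⟩, rfl⟩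
    have hd := Walk.darts_ofDarts (G := G) l hl hw.isChain
    set W := Walk.ofDarts (G := G) l hl hw.isChain
    have h := W.isDartWalk_darts
    refine ⟨W, ⟨?_, ?_, ?_⟩, ?_⟩
    · have h1 := h.dtail_head W.darts_ne_nil
      have h2 := h.dhead_getLast W.darts_ne_nil
      have h3 := hw.dtail_head hl
      have h4 := hw.dhead_getLast hl
      simp only [hd] at h1 h2
      rw [Walk.IsClosed, ← h1, ← h2, h3, h4]
    · rw [← W.nodup_map_dtail, hd]
      exact ht
    · rw [← W.nodup_map_fst, hd]
      exact he
    · rw [W.supp_eq, hd]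
      rfl

theorem isPath_iff [DecidableEq E] {P : Finset E} {a b : V} :
    G.IsPath P a b ↔ ∃ l, G.IsDartPath a l b ∧ dedges l = P := by
  constructor
  · rintro ⟨W, ⟨ht, hn⟩, rfl, rfl, rfl⟩
    refine ⟨W.darts, ⟨W.darts_ne_nil, W.isDartWalk_darts, W.nodup_map_dtail.2 ht, ?_⟩,
      W.supp_eq.symm⟩
    rw [W.mem_map_dtail]
    rintro ⟨i, hi⟩
    exact hn i hi
  · rintro ⟨l, ⟨hl, hw, ht, hn⟩, rfl⟩
    have hd := Walk.darts_ofDarts (G := G) l hl hw.isChain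
    set W := Walk.ofDarts (G := G) l hl hw.isChain
    have h := W.isDartWalk_darts
    have h1 := h.dtail_head W.darts_ne_nil
    have h2 := h.dhead_getLast W.darts_ne_nil
    simp only [hd] at h1 h2
    rw [hw.dtail_head hl] at h1
    rw [hw.dhead_getLast hl] at h2
    refine ⟨W, ⟨?_, ?_⟩, ?_, h1.symm, h2.symm⟩
    · rw [← W.nodup_map_dtail, hd]
      exact ht
    · intro i hi
      refine hn ?_
      rw [← hd, W.mem_map_dtail]
      exact ⟨i, hi.trans h2.symm⟩
    · rw [W.supp_eq, hd]
      rfl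

theorem mem_verts_iff {S : Finset E} {v : V} :
    v ∈ G.verts S ↔ ∃ d : E × Bool, d.1 ∈ S ∧ G.dtail d = v := by
  constructor
  · rintro ⟨e, he, b, h⟩
    exact ⟨(e, b), he, h⟩
  · rintro ⟨d, hd, h⟩
    exact ⟨d.1, hd, d.2, h⟩

theorem dtail_mem_verts {S : Finset E} {d : E × Bool} (h : d.1 ∈ S) : G.dtail d ∈ G.verts S :=
  mem_verts_iff.2 ⟨d, h, rfl⟩

theorem dhead_mem_verts {S : Finset E} {d : E × Bool} (h : d.1 ∈ S) : G.dhead d ∈ G.verts S :=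
  dtail_mem_verts (d := dflip d) h

theorem verts_union [DecidableEq E] (S T : Finset E) :
    G.verts (S ∪ T) = G.verts S ∪ G.verts T := by
  ext v
  simp only [verts, Finset.mem_union, Set.mem_ofPred_eq, Set.mem_union]
  constructor
  · rintro ⟨e, he | he, h⟩
    · exact Or.inl ⟨e, he, h⟩
    · exact Or.inr ⟨e, he, h⟩
  · rintro (⟨e, he, h⟩ | ⟨e, he, h⟩)
    · exact ⟨e, Or.inl he, h⟩
    · exact ⟨e, Or.inr he, h⟩

/-! ### Vertices and edges of simple closed paths and simple paths -/

section

variable [DecidableEq E] {l : List (E × Bool)} {u w v : V}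

theorem mem_dedges {e : E} : e ∈ dedges l ↔ ∃ d ∈ l, d.1 = e := by
  simp only [dedges, List.mem_toFinset, List.mem_map]

theorem fst_mem_dedges {d : E × Bool} (h : d ∈ l) : d.1 ∈ dedges l := mem_dedges.2 ⟨d, h, rfl⟩

theorem mem_or_dflip_mem {d : E × Bool} (h : d.1 ∈ dedges l) : d ∈ l ∨ dflip d ∈ l := by
  obtain ⟨d', h', he⟩ := mem_dedges.1 h
  rcases eq_or_eq_dflip he with rfl | rfl
  · exact Or.inl h'
  · exact Or.inr h'

theorem dedges_nonempty (h : l ≠ []) : (dedges l).Nonempty := by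
  cases l with
  | nil => exact absurd rfl h
  | cons d l => exact ⟨d.1, fst_mem_dedges (by simp)⟩

@[simp] theorem dedges_append (l l' : List (E × Bool)) :
    dedges (l ++ l') = dedges l ∪ dedges l' := by
  simp [dedges]

omit [DecidableEq E] in
theorem IsDartWalk.mem_map_dhead (h : G.IsDartWalk u l w) (v : V) :
    v ∈ l.map G.dtail ∨ v = w ↔ v = u ∨ v ∈ l.map G.dhead := by
  rw [← List.mem_singleton (a := v) (b := w), ← List.mem_append, h.map_dtail_append, List.mem_cons]

theorem IsDartWalk.mem_verts (h : G.IsDartWalk u l w) (hl : l ≠ []) :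
    v ∈ G.verts (dedges l) ↔ v ∈ l.map G.dtail ∨ v = w := by
  rw [mem_verts_iff]
  constructor
  · rintro ⟨d, hd, rfl⟩
    rcases mem_or_dflip_mem hd with hd | hd
    · exact Or.inl (List.mem_map_of_mem hd)
    · rw [h.mem_map_dhead]
      have := List.mem_map_of_mem (f := G.dhead) hd
      rw [dhead_dflip] at this
      exact Or.inr this
  · rintro (hv | rfl)
    · obtain ⟨d, hd, rfl⟩ := List.mem_map.1 hv
      exact ⟨d, fst_mem_dedges hd, rfl⟩
    · exact ⟨dflip (l.getLast hl), fst_mem_dedges (d := l.getLast hl) (List.getLast_mem hl),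
        h.dhead_getLast hl⟩

omit [DecidableEq E] in
-- The vertex sequence begins and ends with `u`; removing either copy leaves the same multiset.
theorem IsDartCycle.perm (h : G.IsDartCycle u l) : (l.map G.dtail).Perm (l.map G.dhead) := by
  have := List.perm_append_singleton u (l.map G.dtail)
  rw [h.walk.map_dtail_append] at this
  exact ((List.perm_cons u).1 this).symm

omit [DecidableEq E] in
theorem IsDartCycle.mem_map_dhead (h : G.IsDartCycle u l) :
    v ∈ l.map G.dhead ↔ v ∈ l.map G.dtail := h.perm.mem_iff.symm

omit [DecidableEq E] in
theorem IsDartCycle.heads (h : G.IsDartCycle u l) : (l.map G.dhead).Nodup :=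
  h.perm.nodup_iff.1 h.tails

omit [DecidableEq E] in
theorem IsDartCycle.base_mem (h : G.IsDartCycle u l) : u ∈ l.map G.dtail := by
  have := h.walk.dtail_head h.ne_nil
  rw [← this]
  exact List.mem_map_of_mem (List.head_mem _)

theorem IsDartCycle.mem_verts (h : G.IsDartCycle u l) :
    v ∈ G.verts (dedges l) ↔ v ∈ l.map G.dtail := by
  rw [h.walk.mem_verts h.ne_nil]
  constructor
  · rintro (hv | rfl)
    · exact hv
    · exact h.base_mem
  · exact Or.inl

/-- A vertex of a simple closed path splits it into two arcs. -/
theorem IsDartCycle.exists_append (h : G.IsDartCycle u l) (hv : v ∈ G.verts (dedges l)) :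
    ∃ A B, l = A ++ B ∧ B ≠ [] ∧ G.IsDartWalk u A v ∧ G.IsDartWalk v B u := by
  rw [h.mem_verts] at hv
  obtain ⟨d, hd, rfl⟩ := List.mem_map.1 hv
  obtain ⟨A, B, rfl⟩ := List.append_of_mem hd
  obtain ⟨x, h1, h2⟩ := isDartWalk_append.1 h.walk
  obtain rfl : G.dtail d = x := h2.1
  exact ⟨A, d :: B, rfl, by simp, h1, h2⟩

theorem IsDartCycle.exists_rotate (h : G.IsDartCycle u l) (hv : v ∈ G.verts (dedges l)) :
    ∃ l', G.IsDartCycle v l' ∧ dedges l' = dedges l := by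
  obtain ⟨A, B, rfl, hB, h1, h2⟩ := h.exists_append hv
  have hp : (B ++ A).Perm (A ++ B) := List.perm_append_comm
  refine ⟨B ++ A, ⟨by simp [hB], isDartWalk_append.2 ⟨u, h2, h1⟩, ?_, ?_⟩, ?_⟩
  · exact (hp.map _).nodup_iff.2 h.tails
  · exact (hp.map _).nodup_iff.2 h.edges
  · simp [Finset.union_comm]

theorem IsCycle.exists_dartCycle {C : Finset E} (hC : G.IsCycle C) (hv : v ∈ G.verts C) :
    ∃ l, G.IsDartCycle v l ∧ dedges l = C := by
  obtain ⟨u, l, hl, rfl⟩ := isCycle_iff.1 hC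
  exact hl.exists_rotate hv

omit [DecidableEq E] in
theorem IsDartPath.nodup (h : G.IsDartPath u l w) : (l.map G.dtail ++ [w]).Nodup := by
  rw [List.nodup_append_comm]
  simpa using ⟨by simpa using h.notMem, h.tails⟩

omit [DecidableEq E] in
theorem IsDartPath.nodup' (h : G.IsDartPath u l w) : (u :: l.map G.dhead).Nodup := by
  rw [← h.walk.map_dtail_append]
  exact h.nodup

omit [DecidableEq E] in
theorem IsDartPath.heads (h : G.IsDartPath u l w) : (l.map G.dhead).Nodup :=
  (List.nodup_cons.1 h.nodup').2

theorem IsDartPath.mem_verts (h : G.IsDartPath u l w) :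
    v ∈ G.verts (dedges l) ↔ v ∈ l.map G.dtail ∨ v = w := h.walk.mem_verts h.ne_nil

/-- The only end of an edge of a simple path at its initial vertex. -/
theorem IsDartPath.eq_head (h : G.IsDartPath u l w) {d : E × Bool} (hd : d.1 ∈ dedges l)
    (hu : G.dtail d = u) : d = l.head h.ne_nil := by
  rcases mem_or_dflip_mem hd with hd | hd
  · refine List.inj_on_of_nodup_map h.tails hd (List.head_mem _) ?_
    rw [hu, h.walk.dtail_head]
  · have := List.mem_map_of_mem (f := G.dhead) hd
    rw [dhead_dflip, hu] at this
    exact absurd this (List.nodup_cons.1 h.nodup').1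

/-- The only end of an edge of a simple path at its terminal vertex. -/
theorem IsDartPath.dflip_eq_getLast (h : G.IsDartPath u l w) {d : E × Bool} (hd : d.1 ∈ dedges l)
    (hw : G.dtail d = w) : dflip d = l.getLast h.ne_nil := by
  rcases mem_or_dflip_mem hd with hd | hd
  · have := List.mem_map_of_mem (f := G.dtail) hd
    rw [hw] at this
    exact absurd this h.notMem
  · refine List.inj_on_of_nodup_map h.heads hd (List.getLast_mem _) ?_
    rw [dhead_dflip, hw, h.walk.dhead_getLast]

omit [DecidableEq E] in
/-- A walk without backtracking that departs from distinct vertices has distinct edges. -/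
theorem nodup_map_fst_of_isChain (ht : (l.map G.dtail).Nodup)
    (hc : l.IsChain fun d d' => G.dhead d = G.dtail d' ∧ d' ≠ dflip d) :
    (l.map Prod.fst).Nodup := by
  rw [List.isChain_iff_getElem] at hc
  rw [List.nodup_iff_injective_getElem] at ht ⊢
  have key : ∀ i j : ℕ, ∀ (hi : i < l.length) (hj : j < l.length), i < j →
      (l[i]).1 ≠ (l[j]).1 := by
    intro i j hi hj hij he
    rcases eq_or_eq_dflip he with h | h
    · have := @ht ⟨i, by simpa⟩ ⟨j, by simpa⟩ (by simp [h])
      simp at this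
      omega
    -- If an edge is traversed in opposite directions at `i < j`, steps `i + 1` and `j` depart from
    -- the same vertex. Hence `j = i + 1`, and the walk backtracks.
    · have h1 := hc i (by omega)
      have h2 : G.dtail l[i + 1] = G.dtail l[j] := by
        rw [← h1.1, h, dhead_dflip]
      have := @ht ⟨i + 1, by simp; omega⟩ ⟨j, by simpa⟩ (by simp [h2])
      simp at this
      subst this
      refine h1.2 ?_
      rw [h, dflip_dflip]
  rintro ⟨i, hi⟩ ⟨j, hj⟩ h
  simp only [List.length_map] at hi hj
  simp only [List.getElem_map] at h
  rcases lt_trichotomy i j with hij | hij | hij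
  · exact absurd h (key i j hi hj hij)
  · simp [hij]
  · exact absurd h.symm (key j i hj hi hij)

omit [DecidableEq E] in
-- Backtracking would bring the path back to the vertex two steps earlier, which is `u` or the head
-- of an earlier dart; both are excluded by distinctness of the vertices.
theorem IsDartPath.edges (h : G.IsDartPath u l w) : (l.map Prod.fst).Nodup := by
  refine nodup_map_fst_of_isChain h.tails ?_
  have hc := h.walk.isChain
  have hn := h.nodup'
  rw [List.isChain_iff_getElem] at hc ⊢
  intro i hi
  refine ⟨hc i hi, fun he => ?_⟩
  have h1 := h.heads
  have h2 := hc i hi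
  have h3 : G.dhead l[i + 1] = G.dtail l[i] := by
    rw [he, dhead_dflip]
  rcases i with - | i
  · have h5 := h.walk.dtail_head h.ne_nil
    rw [List.head_eq_getElem] at h5
    rw [h5] at h3
    refine (List.nodup_cons.1 hn).1 ?_
    rw [← h3]
    exact List.mem_map_of_mem (List.getElem_mem _)
  · have h5 := hc i (by omega)
    rw [← h5] at h3
    have h6 := (List.nodup_iff_injective_getElem.1 h1)
    have := @h6 ⟨i + 1 + 1, by simpa⟩ ⟨i, by simp; omega⟩ (by simp [h3])
    simp only [Fin.mk.injEq] at this
    omega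

end

/-! ### Edge sets without end-vertices -/

/-- No vertex carries exactly one end of the edges in `X`. -/
def Leafless (G : SignedGraph V E) (X : Finset E) : Prop :=
  ∀ d : E × Bool, d.1 ∈ X → ∃ d', d' ≠ d ∧ d'.1 ∈ X ∧ G.dtail d' = G.dtail d

section

variable [DecidableEq E] {l : List (E × Bool)} {u w v : V}

theorem IsDartCycle.leafless (h : G.IsDartCycle u l) : G.Leafless (dedges l) := by
  intro d hd
  rcases mem_or_dflip_mem hd with hd | hd
  · have h1 := h.mem_map_dhead.2 (List.mem_map_of_mem (f := G.dtail) hd)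
    obtain ⟨d', hd', h2⟩ := List.mem_map.1 h1
    refine ⟨dflip d', ?_, fst_mem_dedges (d := d') hd', h2⟩
    rintro rfl
    exact dflip_ne d' (List.inj_on_of_nodup_map h.edges hd hd' rfl)
  · have h1 := h.mem_map_dhead.1 (List.mem_map_of_mem (f := G.dhead) hd)
    obtain ⟨d', hd', h2⟩ := List.mem_map.1 h1
    refine ⟨d', ?_, fst_mem_dedges hd', by simpa using h2⟩
    rintro rfl
    exact dflip_ne d' (List.inj_on_of_nodup_map h.edges hd hd' rfl)

theorem IsCycle.leafless {C : Finset E} (hC : G.IsCycle C) : G.Leafless C := by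
  obtain ⟨u, l, hl, rfl⟩ := isCycle_iff.1 hC
  exact hl.leafless

theorem IsCycle.nonempty {C : Finset E} (hC : G.IsCycle C) : C.Nonempty := by
  obtain ⟨u, l, hl, rfl⟩ := isCycle_iff.1 hC
  exact dedges_nonempty hl.ne_nil

theorem IsPath.nonempty {P : Finset E} {a b : V} (hP : G.IsPath P a b) : P.Nonempty := by
  obtain ⟨l, hl, rfl⟩ := isPath_iff.1 hP
  exact dedges_nonempty hl.ne_nil

/-- A set of edges of `T`, leafless except possibly at `u`, contains all edges of a walk from `u`
whose inner vertices do not lie on other edges of `T`, or none. -/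
theorem dedges_subset_of_leafless {T X : Finset E}
    (hX : ∀ d : E × Bool, d.1 ∈ X → G.dtail d ≠ u →
      ∃ d', d' ≠ d ∧ d'.1 ∈ X ∧ G.dtail d' = G.dtail d) (hXT : X ⊆ T)
    (hw : G.IsDartWalk u l w) (ht : (l.map G.dtail).Nodup) (hh : (l.map G.dhead).Nodup)
    (hT : ∀ d d' : E × Bool, d.1 ∈ T → d' ∈ l → G.dtail d = G.dtail d' →
      (∃ d'' ∈ l, G.dhead d'' = G.dtail d') → G.dtail d' ≠ u → d.1 ∈ dedges l)
    (hu : u ∉ (l.map G.dtail).tail)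
    {e : E} (he : e ∈ X) (hel : e ∈ dedges l) : dedges l ⊆ X := by
  -- At the vertex between two consecutive darts, the only available ends of edges of `X` are those
  -- of the two darts. Since `X` cannot have exactly one of them, it contains both edges or neither.
  have key : l.IsChain fun d d' => d.1 ∈ X ↔ d'.1 ∈ X := by
    have hc := hw.isChain
    rw [List.isChain_iff_getElem] at hc ⊢
    intro i hi
    have hi' := hc i hi
    have hd : l[i] ∈ l := List.getElem_mem _
    have hd' : l[i + 1] ∈ l := List.getElem_mem _
    have hne : G.dtail l[i + 1] ≠ u := by
      rintro rfl
      refine hu ?_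
      rw [List.mem_iff_getElem]
      exact ⟨i, by simp; omega, by simp⟩
    have hor : ∀ d : E × Bool, d.1 ∈ X → G.dtail d = G.dtail l[i + 1] →
        d = l[i + 1] ∨ d = dflip l[i] := by
      intro d hdX hdt
      have := hT d _ (hXT hdX) hd' hdt ⟨_, hd, hi'⟩ hne
      rcases mem_or_dflip_mem this with h | h
      · exact Or.inl (List.inj_on_of_nodup_map ht h hd' hdt)
      · right
        rw [← List.inj_on_of_nodup_map hh h hd (by rw [dhead_dflip, hdt, hi']), dflip_dflip]
    constructor
    · intro h
      obtain ⟨d', h1, h2, h3⟩ := hX (dflip l[i]) h (by rwa [dtail_dflip, hi'])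
      rcases hor d' h2 (h3.trans hi') with rfl | rfl
      · exact h2
      · exact absurd rfl h1
    · intro h
      obtain ⟨d', h1, h2, h3⟩ := hX l[i + 1] h hne
      rcases hor d' h2 h3 with rfl | rfl
      · exact absurd rfl h1
      · exact h2
  have key2 : l.Pairwise fun d d' => d.1 ∈ X ↔ d'.1 ∈ X := by
    have : IsTrans (E × Bool) fun d d' => d.1 ∈ X ↔ d'.1 ∈ X := ⟨fun _ _ _ => Iff.trans⟩
    exact List.isChain_iff_pairwise.1 key
  obtain ⟨d, hd, rfl⟩ := mem_dedges.1 hel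
  intro e' he'
  obtain ⟨d', hd', rfl⟩ := mem_dedges.1 he'
  have : Std.Symm fun d d' : E × Bool => d.1 ∈ X ↔ d'.1 ∈ X := ⟨fun _ _ => Iff.symm⟩
  exact (List.Pairwise.forall_of_forall (R := fun d d' : E × Bool => d.1 ∈ X ↔ d'.1 ∈ X)
    (fun _ _ => Iff.rfl) key2 hd hd').1 he

/-- A set of edges of `T`, leafless except possibly at `v`, contains all edges of a cycle that meets
the other edges of `T` at most in `v`, or none. -/
theorem cycle_subset_of_leafless {T X C : Finset E}
    (hX : ∀ d : E × Bool, d.1 ∈ X → G.dtail d ≠ v →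
      ∃ d', d' ≠ d ∧ d'.1 ∈ X ∧ G.dtail d' = G.dtail d) (hXT : X ⊆ T)
    (hC : G.IsCycle C) (hv : v ∈ G.verts C)
    (hT : ∀ d : E × Bool, d.1 ∈ T → G.dtail d ∈ G.verts C → G.dtail d ≠ v → d.1 ∈ C)
    {e : E} (he : e ∈ X) (heC : e ∈ C) : C ⊆ X := by
  obtain ⟨l, hl, rfl⟩ := hC.exists_dartCycle hv
  refine dedges_subset_of_leafless hX hXT hl.walk hl.tails hl.heads ?_ ?_ he heC
  · intro d d' h1 h2 h3 _ h5
    refine hT d h1 ?_ (by rwa [h3])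
    rw [h3]
    exact dtail_mem_verts (fst_mem_dedges h2)
  · have h1 := hl.walk.dtail_head hl.ne_nil
    have h2 := hl.tails
    cases l with
    | nil => simp
    | cons d l =>
      rw [← h1]
      exact (List.nodup_cons.1 h2).1

/-- A leafless set of edges of `T` contains all edges of a simple path that meets the other edges of
`T` only in its ends, or none. -/
theorem Leafless.path_subset {T X P : Finset E} {a b : V} (hX : G.Leafless X) (hXT : X ⊆ T)
    (hP : G.IsPath P a b)
    (hT : ∀ d : E × Bool, d.1 ∈ T → G.dtail d ∈ G.verts P → G.dtail d ≠ a → G.dtail d ≠ b →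
      d.1 ∈ P)
    {e : E} (he : e ∈ X) (heP : e ∈ P) : P ⊆ X := by
  obtain ⟨l, hl, rfl⟩ := isPath_iff.1 hP
  refine dedges_subset_of_leafless (fun d h _ => hX d h) hXT hl.walk hl.tails hl.heads ?_ ?_ he heP
  · intro d d' h1 h2 h3 _ h5
    refine hT d h1 ?_ (by rwa [h3]) ?_
    · rw [h3]
      exact dtail_mem_verts (fst_mem_dedges h2)
    · rintro rfl
      refine hl.notMem ?_
      rw [h3]
      exact List.mem_map_of_mem h2
  · have h1 := hl.walk.dtail_head hl.ne_nil
    have h2 := hl.tails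
    cases l with
    | nil => simp
    | cons d l =>
      rw [← h1]
      exact (List.nodup_cons.1 h2).1

/-- With `T = C` there are no other edges to meet, so one edge of the cycle drags in the rest. -/
theorem Leafless.eq_cycle {X C : Finset E} (hX : G.Leafless X) (hne : X.Nonempty)
    (hC : G.IsCycle C) (hXC : X ⊆ C) : X = C := by
  obtain ⟨e, he⟩ := hne
  refine hXC.antisymm ?_
  exact cycle_subset_of_leafless (fun d h _ => hX d h) hXC hC
    (dtail_mem_verts (d := (e, true)) (hXC he)) (fun d h _ _ => h) he
    (hXC he)

end

section

variable [DecidableEq E] {C C₁ C₂ P X T S S' : Finset E} {a b v : V}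

/-! ### Cycles in the union of two cycles and a path -/

omit [DecidableEq E] in
theorem verts_nonempty (h : S.Nonempty) : (G.verts S).Nonempty := by
  obtain ⟨e, he⟩ := h
  exact ⟨_, dtail_mem_verts (d := (e, true)) he⟩

theorem IsCycle.eq_of_subset (hC₁ : G.IsCycle C₁) (hC : G.IsCycle C) (h : C₁ ⊆ C) : C₁ = C :=
  hC₁.leafless.eq_cycle hC₁.nonempty hC h

omit [DecidableEq E] in
theorem disjoint_of_disjoint_verts (h : Disjoint (G.verts S) (G.verts S')) : Disjoint S S' := by
  rw [Finset.disjoint_left]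
  intro e h1 h2
  exact Set.disjoint_left.1 h (dtail_mem_verts (d := (e, true)) h1)
    (dtail_mem_verts (d := (e, true)) h2)

omit [DecidableEq E] in
theorem eq_of_mem_verts (h : G.verts S ∩ G.verts S' = {v}) {x : V} (hx : x ∈ G.verts S)
    (hx' : x ∈ G.verts S') : x = v := by
  have : x ∈ G.verts S ∩ G.verts S' := ⟨hx, hx'⟩
  rw [h] at this
  exact this

omit [DecidableEq E] in
theorem mem_of_inter_eq (h : G.verts S ∩ G.verts S' = {v}) : v ∈ G.verts S ∧ v ∈ G.verts S' := by
  have : v ∈ G.verts S ∩ G.verts S' := by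
    rw [h]
    rfl
  exact this

theorem IsPath.not_isLoop (h : G.IsPath P a b) {d : E × Bool} (hd : d.1 ∈ P) :
    G.dtail d ≠ G.dhead d := by
  obtain ⟨l, hl, rfl⟩ := isPath_iff.1 h
  have key : ∀ d ∈ l, G.dtail d ≠ G.dhead d := by
    intro d hd he
    obtain ⟨A, B, rfl⟩ := List.append_of_mem hd
    have hw := hl.walk
    have ht := hl.nodup
    obtain ⟨x, -, h2⟩ := isDartWalk_append.1 hw
    have h3 := h2.2.map_dtail_append
    -- The two ends of `d` are consecutive entries of the vertex sequence, which has no repetition.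
    have h4 : List.map G.dtail (A ++ d :: B) ++ [b]
        = A.map G.dtail ++ (G.dtail d :: (G.dhead d :: B.map G.dhead)) := by
      simp [← h3]
    rw [h4, he] at ht
    have := (List.nodup_append.1 ht).2.1
    simp at this
  rcases mem_or_dflip_mem hd with h | h
  · exact key d h
  · have := key _ h
    rw [dtail_dflip, dhead_dflip] at this
    exact this.symm

/-- A common edge would have both ends at the single common vertex, and a simple path contains no
loop. -/
theorem IsPath.disjoint (hP : G.IsPath P a b) (h : G.verts S ∩ G.verts P = {v}) :
    Disjoint S P := by
  rw [Finset.disjoint_left]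
  intro e h1 h2
  refine hP.not_isLoop (d := (e, true)) h2 ?_
  rw [eq_of_mem_verts h (dtail_mem_verts h1) (dtail_mem_verts h2),
    eq_of_mem_verts h (dhead_mem_verts (d := (e, true)) h1) (dhead_mem_verts h2)]

theorem Leafless.cycle_subset_or_disjoint (hX : G.Leafless X) (hXT : X ⊆ T) (hC : G.IsCycle C)
    (hv : v ∈ G.verts C)
    (hT : ∀ d : E × Bool, d.1 ∈ T → G.dtail d ∈ G.verts C → G.dtail d ≠ v → d.1 ∈ C) :
    C ⊆ X ∨ Disjoint X C := by
  rw [or_iff_not_imp_right, Finset.not_disjoint_iff]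
  rintro ⟨e, he, heC⟩
  exact cycle_subset_of_leafless (fun d h _ => hX d h) hXT hC hv hT he heC

theorem eq_or_eq_or_eq_of_subset_union (hne : X.Nonempty) (hXT : X ⊆ C₁ ∪ C₂)
    (h₁ : C₁ ⊆ X ∨ Disjoint X C₁) (h₂ : C₂ ⊆ X ∨ Disjoint X C₂) :
    X = C₁ ∨ X = C₂ ∨ X = C₁ ∪ C₂ := by
  have hd : ∀ {A B : Finset E}, X ⊆ A ∪ B → Disjoint X A → X ⊆ B := fun hAB hA e he =>
    (Finset.mem_union.1 (hAB he)).resolve_left fun h => Finset.disjoint_left.1 hA he h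
  rcases h₁ with h₁ | h₁ <;> rcases h₂ with h₂ | h₂
  · exact Or.inr (Or.inr (hXT.antisymm (Finset.union_subset h₁ h₂)))
  · exact Or.inl ((hd (Finset.union_comm C₁ C₂ ▸ hXT) h₂).antisymm h₁)
  · exact Or.inr (Or.inl ((hd hXT h₁).antisymm h₂))
  · obtain ⟨e, he⟩ := hne
    exact absurd (hd hXT h₁ he) (Finset.disjoint_left.1 h₂ he)

theorem Leafless.eq_of_subset_union (hX : G.Leafless X) (hne : X.Nonempty) (hC₁ : G.IsCycle C₁)
    (hC₂ : G.IsCycle C₂) (hv : G.verts C₁ ∩ G.verts C₂ = {v}) (hXT : X ⊆ C₁ ∪ C₂) :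
    X = C₁ ∨ X = C₂ ∨ X = C₁ ∪ C₂ := by
  refine eq_or_eq_or_eq_of_subset_union hne hXT
    (hX.cycle_subset_or_disjoint hXT hC₁ (mem_of_inter_eq hv).1 ?_)
    (hX.cycle_subset_or_disjoint hXT hC₂ (mem_of_inter_eq hv).2 ?_)
  · intro d hd h1 h2
    refine (Finset.mem_union.1 hd).resolve_right fun h => h2 ?_
    exact eq_of_mem_verts hv h1 (dtail_mem_verts h)
  · intro d hd h1 h2
    refine (Finset.mem_union.1 hd).resolve_left fun h => h2 ?_
    exact eq_of_mem_verts hv (dtail_mem_verts h) h1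

/-- Each of the three pieces lies inside `X` or is disjoint from it, and `P` cannot occur without
both cycles. -/
theorem Leafless.eq_of_subset_union_path (hX : G.Leafless X) (hne : X.Nonempty)
    (hC₁ : G.IsCycle C₁) (hC₂ : G.IsCycle C₂) (hd : Disjoint (G.verts C₁) (G.verts C₂))
    (hP : G.IsPath P a b) (ha : G.verts C₁ ∩ G.verts P = {a}) (hb : G.verts C₂ ∩ G.verts P = {b})
    (hXT : X ⊆ C₁ ∪ P ∪ C₂) :
    X = C₁ ∨ X = C₂ ∨ X = C₁ ∪ C₂ ∨ X = C₁ ∪ P ∪ C₂ := by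
  have hdis : ∀ x, x ∈ G.verts C₁ → x ∉ G.verts C₂ := fun x h => Set.disjoint_left.1 hd h
  have h₁ : C₁ ⊆ X ∨ Disjoint X C₁ := by
    refine hX.cycle_subset_or_disjoint hXT hC₁ (mem_of_inter_eq ha).1 ?_
    intro d h h1 h2
    simp only [Finset.mem_union] at h
    rcases h with (h | h) | h
    · exact h
    · exact absurd (eq_of_mem_verts ha h1 (dtail_mem_verts h)) h2
    · exact absurd (dtail_mem_verts h) (hdis _ h1)
  have h₂ : C₂ ⊆ X ∨ Disjoint X C₂ := by
    refine hX.cycle_subset_or_disjoint hXT hC₂ (mem_of_inter_eq hb).1 ?_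
    intro d h h1 h2
    simp only [Finset.mem_union] at h
    rcases h with (h | h) | h
    · exact absurd h1 (hdis _ (dtail_mem_verts h))
    · exact absurd (eq_of_mem_verts hb h1 (dtail_mem_verts h)) h2
    · exact h
  by_cases hXP : Disjoint X P
  · have hXT' : X ⊆ C₁ ∪ C₂ := by
      intro e he
      have := hXT he
      simp only [Finset.mem_union] at this ⊢
      rcases this with (h | h) | h
      · exact Or.inl h
      · exact absurd h (Finset.disjoint_left.1 hXP he)
      · exact Or.inr h
    rcases eq_or_eq_or_eq_of_subset_union hne hXT' h₁ h₂ with h | h | h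
    · exact Or.inl h
    · exact Or.inr (Or.inl h)
    · exact Or.inr (Or.inr (Or.inl h))
  · obtain ⟨e, he, heP⟩ := Finset.not_disjoint_iff.1 hXP
    have hPX : P ⊆ X := by
      refine hX.path_subset hXT hP ?_ he heP
      intro d h h1 h2 h3
      simp only [Finset.mem_union] at h
      rcases h with (h | h) | h
      · exact absurd (eq_of_mem_verts ha (dtail_mem_verts h) h1) h2
      · exact h
      · exact absurd (eq_of_mem_verts hb (dtail_mem_verts h) h1) h3
    right; right; right
    refine hXT.antisymm (Finset.union_subset (Finset.union_subset ?_ hPX) ?_)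
    -- The path has only one end at `a`, so `X` needs another one there, and only `C₁` can supply
    -- it. The same argument applies to `C₂` at `b`.
    · refine h₁.resolve_right fun h => ?_
      obtain ⟨l, hl, rfl⟩ := isPath_iff.1 hP
      have hh := hl.walk.dtail_head hl.ne_nil
      have hm : (l.head hl.ne_nil).1 ∈ dedges l := fst_mem_dedges (List.head_mem _)
      obtain ⟨d, hne, hdX, hda⟩ := hX _ (hPX hm)
      rw [hh] at hda
      have := hXT hdX
      simp only [Finset.mem_union] at this
      rcases this with (h' | h') | h'
      · exact Finset.disjoint_left.1 h hdX h'
      · exact hne (hl.eq_head h' hda)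
      · refine hdis a (mem_of_inter_eq ha).1 ?_
        rw [← hda]
        exact dtail_mem_verts h'
    · refine h₂.resolve_right fun h => ?_
      obtain ⟨l, hl, rfl⟩ := isPath_iff.1 hP
      have hh := hl.walk.dhead_getLast hl.ne_nil
      have hm : (l.getLast hl.ne_nil).1 ∈ dedges l := fst_mem_dedges (List.getLast_mem _)
      obtain ⟨d, hne, hdX, hda⟩ := hX (dflip (l.getLast hl.ne_nil)) (hPX hm)
      rw [dtail_dflip, hh] at hda
      have := hXT hdX
      simp only [Finset.mem_union] at this
      rcases this with (h' | h') | h'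
      · refine hdis b ?_ (mem_of_inter_eq hb).1
        rw [← hda]
        exact dtail_mem_verts h'
      · refine hne ?_
        rw [← hl.dflip_eq_getLast h' hda, dflip_dflip]
      · exact Finset.disjoint_left.1 h hdX h'

theorem IsCycle.eq_of_subset_union (hC : G.IsCycle C) (hC₁ : G.IsCycle C₁)
    (hC₂ : G.IsCycle C₂) (hv : G.verts C₁ ∩ G.verts C₂ = {v}) (h : C ⊆ C₁ ∪ C₂) :
    C = C₁ ∨ C = C₂ := by
  rcases hC.leafless.eq_of_subset_union hC.nonempty hC₁ hC₂ hv h with h | h | h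
  · exact Or.inl h
  · exact Or.inr h
  · exact Or.inl (hC₁.eq_of_subset hC (h ▸ Finset.subset_union_left)).symm

theorem IsCycle.eq_of_subset_union_path (hC : G.IsCycle C) (hC₁ : G.IsCycle C₁)
    (hC₂ : G.IsCycle C₂) (hd : Disjoint (G.verts C₁) (G.verts C₂))
    (hP : G.IsPath P a b) (ha : G.verts C₁ ∩ G.verts P = {a}) (hb : G.verts C₂ ∩ G.verts P = {b})
    (h : C ⊆ C₁ ∪ P ∪ C₂) : C = C₁ ∨ C = C₂ := by
  rcases hC.leafless.eq_of_subset_union_path hC.nonempty hC₁ hC₂ hd hP ha hb h with h | h | h | h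
  · exact Or.inl h
  · exact Or.inr h
  · exact Or.inl (hC₁.eq_of_subset hC (h ▸ Finset.subset_union_left)).symm
  · exact Or.inr (hC₂.eq_of_subset hC (h ▸ Finset.subset_union_right)).symm

/-! ### The three types form an antichain -/

/-- Edge sets of Types I, II and III. -/
def IsTyped (G : SignedGraph V E) (T : Finset E) : Prop :=
  G.IsTypeI T ∨ G.IsTypeII T ∨ G.IsTypeIII T

/-- A cycle properly contains no cycle, so the two disjoint cycles of Type II or III would both have
to equal `C`. -/
theorem IsUnbalancedCycle.not_isTyped (hC : G.IsUnbalancedCycle C) : ¬ G.IsTyped C := by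
  rintro (h | ⟨C₁, C₂, h₁, h₂, hd, -, rfl⟩ | ⟨C₁, C₂, P, a, b, h₁, h₂, hd, -, -, -, rfl⟩)
  · exact hC.2 h.2
  · have e₁ := h₁.1.eq_of_subset hC.1 Finset.subset_union_left
    have e₂ := h₂.1.eq_of_subset hC.1 Finset.subset_union_right
    rw [e₁.trans e₂.symm, disjoint_self] at hd
    exact h₂.1.nonempty.ne_empty hd
  · have e₁ := h₁.1.eq_of_subset hC.1
      (Finset.subset_union_left.trans Finset.subset_union_left)
    have e₂ := h₂.1.eq_of_subset hC.1 Finset.subset_union_right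
    rw [e₁.trans e₂.symm, disjoint_self] at hd
    exact (verts_nonempty h₂.1.nonempty).ne_empty hd

theorem IsTyped.nonempty (h : G.IsTyped T) : T.Nonempty := by
  rcases h with h | ⟨C₁, C₂, h₁, h₂, hd, -, rfl⟩ | ⟨C₁, C₂, P, a, b, h₁, h₂, hd, -, -, -, rfl⟩
  · exact h.1.nonempty
  · exact h₁.1.nonempty.mono Finset.subset_union_left
  · exact h₂.1.nonempty.mono Finset.subset_union_right

/-- The leafless subsets of `T` are known, and a single unbalanced cycle is not typed. Leaflessness
of `X` is assumed here; it is supplied later by a flow with support `X`. -/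
theorem IsTyped.eq_of_subset (hT : G.IsTyped T) (hX : G.IsTyped X) (hl : G.Leafless X)
    (h : X ⊆ T) : X = T := by
  have hne := hX.nonempty
  rcases hT with hT | ⟨C₁, C₂, h₁, h₂, hd, ⟨v, hv⟩, rfl⟩ |
    ⟨C₁, C₂, P, a, b, h₁, h₂, hd, hP, ha, hb, rfl⟩
  · exact hl.eq_cycle hne hT.1 h
  · rcases hl.eq_of_subset_union hne h₁.1 h₂.1 hv h with rfl | rfl | h
    · exact absurd hX h₁.not_isTyped
    · exact absurd hX h₂.not_isTyped
    · exact h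
  · rcases hl.eq_of_subset_union_path hne h₁.1 h₂.1 hd hP ha hb h with rfl | rfl | h' | h'
    · exact absurd hX h₁.not_isTyped
    · exact absurd hX h₂.not_isTyped
    -- Here `X` consists of two vertex-disjoint unbalanced cycles and contains no others. Type I
    -- would make them equal, Type II would make them meet, and the path of Type III would have no
    -- edges left.
    · exfalso
      have key : ∀ {C C' : Finset E}, G.IsCycle C → G.IsCycle C' → C ⊆ X → C' ⊆ X → C ≠ C' →
          (C = C₁ ∧ C' = C₂) ∨ (C = C₂ ∧ C' = C₁) := by
        intro C C' hC hC' hs hs' hn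
        rcases hC.eq_of_subset_union_path h₁.1 h₂.1 hd hP ha hb (hs.trans h) with e | e <;>
        rcases hC'.eq_of_subset_union_path h₁.1 h₂.1 hd hP ha hb (hs'.trans h) with e' | e'
        · exact absurd (e.trans e'.symm) hn
        · exact Or.inl ⟨e, e'⟩
        · exact Or.inr ⟨e, e'⟩
        · exact absurd (e.trans e'.symm) hn
      rcases hX with hX | ⟨D₁, D₂, g₁, g₂, gd, ⟨v, hv⟩, rfl⟩ |
        ⟨D₁, D₂, Q, a', b', g₁, g₂, gd, hQ, ha', hb', rfl⟩
      · have e₁ := h₁.1.eq_of_subset hX.1 (h' ▸ Finset.subset_union_left)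
        have e₂ := h₂.1.eq_of_subset hX.1 (h' ▸ Finset.subset_union_right)
        rw [e₁.trans e₂.symm, disjoint_self] at hd
        exact (verts_nonempty h₂.1.nonempty).ne_empty hd
      · have hv' := mem_of_inter_eq hv
        rcases key g₁.1 g₂.1 Finset.subset_union_left Finset.subset_union_right (by
          rintro rfl
          exact g₁.1.nonempty.ne_empty (disjoint_self.1 gd)) with ⟨rfl, rfl⟩ | ⟨rfl, rfl⟩
        · exact Set.disjoint_left.1 hd hv'.1 hv'.2
        · exact Set.disjoint_left.1 hd hv'.2 hv'.1
      · have hQ' : Q ⊆ D₁ ∪ D₂ := by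
          have : Q ⊆ C₁ ∪ C₂ := h' ▸ (Finset.subset_union_right.trans Finset.subset_union_left)
          rcases key g₁.1 g₂.1 (Finset.subset_union_left.trans Finset.subset_union_left)
            Finset.subset_union_right (by
            rintro rfl
            exact (verts_nonempty g₁.1.nonempty).ne_empty (disjoint_self.1 gd)) with
            ⟨rfl, rfl⟩ | ⟨rfl, rfl⟩
          · exact this
          · exact Finset.union_comm D₂ D₁ ▸ this
        obtain ⟨e, he⟩ := hQ.nonempty
        rcases Finset.mem_union.1 (hQ' he) with h | h
        · exact Finset.disjoint_left.1 (hQ.disjoint ha') h he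
        · exact Finset.disjoint_left.1 (hQ.disjoint hb') h he
    · exact h'

/-! ### Connectedness -/

omit [DecidableEq E] in
theorem isConnected_of_forall {u : V} (hS : S.Nonempty)
    (h : ∀ v ∈ G.verts S, Relation.ReflTransGen
      (fun a b => ∃ e ∈ S, ∃ s, G.ends e s = a ∧ G.ends e (!s) = b) u v) : G.IsConnected S := by
  refine ⟨hS, fun x hx y hy => ?_⟩
  have hsymm : Std.Symm
      (fun a b : V => ∃ e ∈ S, ∃ s, G.ends e s = a ∧ G.ends e (!s) = b) := by
    refine ⟨?_⟩
    rintro x y ⟨e, he, s, h1, h2⟩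
    exact ⟨e, he, !s, h2, by simpa using h1⟩
  exact (Std.Symm.symm _ _ (h x hx)).trans (h y hy)

omit [DecidableEq E] in
theorem IsDartWalk.reflTransGen {l : List (E × Bool)} {u w : V} (h : G.IsDartWalk u l w)
    (hS : ∀ d ∈ l, d.1 ∈ S) :
    Relation.ReflTransGen (fun a b => ∃ e ∈ S, ∃ s, G.ends e s = a ∧ G.ends e (!s) = b) u w := by
  induction l generalizing u with
  | nil =>
    obtain rfl : u = w := h
    exact Relation.ReflTransGen.refl
  | cons d l ih =>
    refine Relation.ReflTransGen.head ⟨d.1, hS d (by simp), d.2, h.1, rfl⟩ (ih h.2 ?_)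
    exact fun d' hd' => hS d' (by simp [hd'])

theorem IsDartWalk.isConnected {l : List (E × Bool)} {u w : V} (h : G.IsDartWalk u l w)
    (hl : l ≠ []) : G.IsConnected (dedges l) := by
  refine isConnected_of_forall (u := u) (dedges_nonempty hl) fun v hv => ?_
  rcases (h.mem_verts hl).1 hv with hv | rfl
  · obtain ⟨d, hd, rfl⟩ := List.mem_map.1 hv
    obtain ⟨A, B, rfl⟩ := List.append_of_mem hd
    obtain ⟨x, h1, h2⟩ := isDartWalk_append.1 h
    obtain rfl : G.dtail d = x := h2.1
    exact h1.reflTransGen fun d' hd' => fst_mem_dedges (by simp [hd'])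
  · exact h.reflTransGen fun d hd => fst_mem_dedges hd

theorem IsCycle.isConnected (h : G.IsCycle C) : G.IsConnected C := by
  obtain ⟨u, l, hl, rfl⟩ := isCycle_iff.1 h
  exact hl.walk.isConnected hl.ne_nil

theorem IsPath.isConnected (h : G.IsPath P a b) : G.IsConnected P := by
  obtain ⟨l, hl, rfl⟩ := isPath_iff.1 h
  exact hl.walk.isConnected hl.ne_nil

theorem IsConnected.union (h : G.IsConnected S) (h' : G.IsConnected S') (hv : v ∈ G.verts S)
    (hv' : v ∈ G.verts S') : G.IsConnected (S ∪ S') := by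
  refine isConnected_of_forall (u := v) (h.1.mono Finset.subset_union_left) fun x hx => ?_
  rw [verts_union] at hx
  rcases hx with hx | hx
  · refine Relation.ReflTransGen.mono ?_ _ _ (h.2 v hv x hx)
    rintro a b ⟨e, he, hs⟩
    exact ⟨e, Finset.mem_union_left _ he, hs⟩
  · refine Relation.ReflTransGen.mono ?_ _ _ (h'.2 v hv' x hx)
    rintro a b ⟨e, he, hs⟩
    exact ⟨e, Finset.mem_union_right _ he, hs⟩

/-! ### Edge sets of the three types are Eulerian cycle-trees -/

theorem IsTypeI.isEulerianCycleTree (h : G.IsTypeI T) : G.IsEulerianCycleTree T := by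
  have huniq : ∀ {C}, C ⊆ T → G.IsCycle C → C = T := fun hs hC => hC.eq_of_subset h.1 hs
  have hno : ∀ v, ¬ G.IsIntersectionVertex T ∅ v := by
    rintro v (⟨C, C', hs, hs', hC, hC', hne, -⟩ | ⟨C, P, hP, -⟩)
    · exact hne ((huniq hs hC).trans (huniq hs' hC').symm)
    · simp at hP
  refine ⟨∅, ⟨h.1.isConnected, ?_, ?_, ?_, ?_, ?_, ?_, ?_⟩, ?_⟩
  · intro e
    simp only [Finset.notMem_empty, false_and, exists_false, or_false]
    exact ⟨fun he => ⟨T, subset_rfl, h.1, he⟩, fun ⟨C, hs, _, he⟩ => hs he⟩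
  · intro C C' hs hs' hC hC' hne
    exact absurd ((huniq hs hC).trans (huniq hs' hC').symm) hne
  · simp
  · simp
  · intro C C' hs hs' hC hC' hne
    exact absurd ((huniq hs hC).trans (huniq hs' hC').symm) hne
  · simp
  · exact fun v hv => absurd hv (hno v)
  · intro C hs hC
    obtain rfl := huniq hs hC
    refine ⟨fun _ => ?_, fun hn => absurd h.2 hn⟩
    simp [hno]

/-- The two given cycles are the only ones, so `v` is the only intersection vertex: one on each
unbalanced cycle, and it separates the two. -/
theorem IsTypeII.isEulerianCycleTree (h : G.IsTypeII T) : G.IsEulerianCycleTree T := by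
  obtain ⟨C₁, C₂, h₁, h₂, hd, ⟨v, hv⟩, rfl⟩ := h
  obtain ⟨hv₁, hv₂⟩ := mem_of_inter_eq hv
  have huniq : ∀ {C}, C ⊆ C₁ ∪ C₂ → G.IsCycle C → C = C₁ ∨ C = C₂ :=
    fun hs hC => hC.eq_of_subset_union h₁.1 h₂.1 hv hs
  have hpair : ∀ {C C'}, C ⊆ C₁ ∪ C₂ → C' ⊆ C₁ ∪ C₂ → G.IsCycle C → G.IsCycle C' → C ≠ C' →
      (C = C₁ ∧ C' = C₂) ∨ (C = C₂ ∧ C' = C₁) := by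
    intro C C' hs hs' hC hC' hne
    rcases huniq hs hC with rfl | rfl <;> rcases huniq hs' hC' with rfl | rfl <;> simp_all
  have hne : C₁ ≠ C₂ := by
    rintro rfl
    exact h₁.1.nonempty.ne_empty (disjoint_self.1 hd)
  have hint : ∀ x, G.IsIntersectionVertex (C₁ ∪ C₂) ∅ x ↔ x = v := by
    intro x
    constructor
    · rintro (⟨C, C', hs, hs', hC, hC', hne, hx, hx'⟩ | ⟨C, P, hP, -⟩)
      · rcases hpair hs hs' hC hC' hne with ⟨rfl, rfl⟩ | ⟨rfl, rfl⟩
        · exact eq_of_mem_verts hv hx hx'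
        · exact eq_of_mem_verts hv hx' hx
      · simp at hP
    · rintro rfl
      exact Or.inl ⟨C₁, C₂, Finset.subset_union_left, Finset.subset_union_right, h₁.1, h₂.1, hne,
        hv₁, hv₂⟩
  refine ⟨∅, ⟨h₁.1.isConnected.union h₂.1.isConnected hv₁ hv₂, ?_, ?_, ?_, ?_, ?_, ?_, ?_⟩, ?_⟩
  · intro e
    simp only [Finset.notMem_empty, false_and, exists_false, or_false]
    refine ⟨fun he => ?_, fun ⟨C, hs, _, he⟩ => hs he⟩
    rcases Finset.mem_union.1 he with he | he
    · exact ⟨C₁, Finset.subset_union_left, h₁.1, he⟩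
    · exact ⟨C₂, Finset.subset_union_right, h₂.1, he⟩
  · intro C C' hs hs' hC hC' hne
    rcases hpair hs hs' hC hC' hne with ⟨rfl, rfl⟩ | ⟨rfl, rfl⟩
    · exact hd
    · exact hd.symm
  · simp
  · simp
  · intro C C' hs hs' hC hC' hne x hx y hy
    rcases hpair hs hs' hC hC' hne with ⟨rfl, rfl⟩ | ⟨rfl, rfl⟩
    · exact (eq_of_mem_verts hv hx.1 hx.2).trans (eq_of_mem_verts hv hy.1 hy.2).symm
    · exact (eq_of_mem_verts hv hx.2 hx.1).trans (eq_of_mem_verts hv hy.2 hy.1).symm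
  · simp
  · intro x hx
    obtain rfl := (hint x).1 hx
    exact ⟨C₁, C₂, h₁.1.nonempty, h₂.1.nonempty, hd, rfl, hv⟩
  · intro C hs hC
    have hset : {x | x ∈ G.verts C ∧ G.IsIntersectionVertex (C₁ ∪ C₂) ∅ x} = {v} := by
      ext x
      simp only [hint, Set.mem_ofPred_eq, Set.mem_singleton_iff, and_iff_right_iff_imp]
      rintro rfl
      rcases huniq hs hC with rfl | rfl
      · exact hv₁
      · exact hv₂
    rw [hset]
    refine ⟨fun hb => ?_, fun _ => by simp⟩
    rcases huniq hs hC with rfl | rfl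
    · exact absurd hb h₁.2
    · exact absurd hb h₂.2

/-- Since `C₁` and `C₂` are the only cycles, the intersection vertices are `a` and `b`, one on each
cycle. Each cuts its cycle off from the rest. -/
theorem IsTypeIII.isEulerianCycleTree (h : G.IsTypeIII T) : G.IsEulerianCycleTree T := by
  obtain ⟨C₁, C₂, P, a, b, h₁, h₂, hd, hP, ha, hb, rfl⟩ := h
  obtain ⟨ha₁, ha₂⟩ := mem_of_inter_eq ha
  obtain ⟨hb₁, hb₂⟩ := mem_of_inter_eq hb
  set T := C₁ ∪ P ∪ C₂ with hT
  have s₁ : C₁ ⊆ T := Finset.subset_union_left.trans Finset.subset_union_left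
  have s₂ : C₂ ⊆ T := Finset.subset_union_right
  have hdis : ∀ {x}, x ∈ G.verts C₁ → x ∉ G.verts C₂ := fun h => Set.disjoint_left.1 hd h
  have huniq : ∀ {C}, C ⊆ T → G.IsCycle C → C = C₁ ∨ C = C₂ :=
    fun hs hC => hC.eq_of_subset_union_path h₁.1 h₂.1 hd hP ha hb hs
  have hpair : ∀ {C C'}, C ⊆ T → C' ⊆ T → G.IsCycle C → G.IsCycle C' → C ≠ C' →
      (C = C₁ ∧ C' = C₂) ∨ (C = C₂ ∧ C' = C₁) := by
    intro C C' hs hs' hC hC' hne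
    rcases huniq hs hC with rfl | rfl <;> rcases huniq hs' hC' with rfl | rfl <;> simp_all
  have hne : C₁ ≠ C₂ := by
    rintro rfl
    exact hdis ha₁ ha₁
  have hint : ∀ x, G.IsIntersectionVertex T {P} x ↔ x = a ∨ x = b := by
    intro x
    constructor
    · rintro (⟨C, C', hs, hs', hC, hC', hne, hx, hx'⟩ | ⟨C, Q, hQ, hs, hC, hx, hx'⟩)
      · rcases hpair hs hs' hC hC' hne with ⟨rfl, rfl⟩ | ⟨rfl, rfl⟩
        · exact absurd hx' (hdis hx)
        · exact absurd hx (hdis hx')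
      · obtain rfl := Finset.mem_singleton.1 hQ
        rcases huniq hs hC with rfl | rfl
        · exact Or.inl (eq_of_mem_verts ha hx hx')
        · exact Or.inr (eq_of_mem_verts hb hx hx')
    · rintro (rfl | rfl)
      · exact Or.inr ⟨C₁, P, by simp, s₁, h₁.1, ha₁, ha₂⟩
      · exact Or.inr ⟨C₂, P, by simp, s₂, h₂.1, hb₁, hb₂⟩
  have hd₁ : Disjoint C₁ P := hP.disjoint ha
  have hd₂ : Disjoint C₂ P := hP.disjoint hb
  have hd₃ : Disjoint C₁ C₂ := disjoint_of_disjoint_verts hd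
  refine ⟨{P}, ⟨?_, ?_, ?_, ?_, ?_, ?_, ?_, ?_⟩, ?_⟩
  · refine (h₁.1.isConnected.union hP.isConnected ha₁ ha₂).union h₂.1.isConnected
      (v := b) ?_ hb₁
    rw [verts_union]
    exact Or.inr hb₂
  · intro e
    simp only [Finset.mem_singleton, exists_eq_left]
    constructor
    · intro he
      simp only [hT, Finset.mem_union] at he
      rcases he with (he | he) | he
      · exact Or.inl ⟨C₁, s₁, h₁.1, he⟩
      · exact Or.inr he
      · exact Or.inl ⟨C₂, s₂, h₂.1, he⟩
    · rintro (⟨C, hs, _, he⟩ | he)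
      · exact hs he
      · simp [hT, he]
  · intro C C' hs hs' hC hC' hne
    rcases hpair hs hs' hC hC' hne with ⟨rfl, rfl⟩ | ⟨rfl, rfl⟩
    · exact hd₃
    · exact hd₃.symm
  · intro C hs hC Q hQ
    obtain rfl := Finset.mem_singleton.1 hQ
    rcases huniq hs hC with rfl | rfl
    · exact hd₁
    · exact hd₂
  · intro Q hQ Q' hQ' hne
    exact absurd ((Finset.mem_singleton.1 hQ).trans (Finset.mem_singleton.1 hQ').symm) hne
  · intro C C' hs hs' hC hC' hne x hx
    rcases hpair hs hs' hC hC' hne with ⟨rfl, rfl⟩ | ⟨rfl, rfl⟩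
    · exact absurd hx.2 (hdis hx.1)
    · exact absurd hx.1 (hdis hx.2)
  · intro Q hQ
    obtain rfl := Finset.mem_singleton.1 hQ
    refine ⟨a, b, hP, C₁, C₂, s₁, s₂, h₁.1, h₂.1, hne, ha, hb, fun C hs hC n₁ n₂ => ?_⟩
    rcases huniq hs hC with rfl | rfl
    · exact absurd rfl n₁
    · exact absurd rfl n₂
  · intro x hx
    rcases (hint x).1 hx with rfl | rfl
    · refine ⟨C₁, P ∪ C₂, h₁.1.nonempty, hP.nonempty.mono Finset.subset_union_left, ?_, ?_, ?_⟩
      · exact Finset.disjoint_union_right.2 ⟨hd₁, hd₃⟩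
      · rw [hT, Finset.union_assoc]
      · rw [verts_union, Set.inter_union_distrib_left, ha, hd.inter_eq, Set.union_empty]
    · refine ⟨C₂, C₁ ∪ P, h₂.1.nonempty, h₁.1.nonempty.mono Finset.subset_union_left, ?_, ?_, ?_⟩
      · exact Finset.disjoint_union_right.2 ⟨hd₃.symm, hd₂⟩
      · rw [hT, Finset.union_comm]
      · rw [verts_union, Set.inter_union_distrib_left, hb, hd.symm.inter_eq, Set.empty_union]
  · intro C hs hC
    have hset : ∃ v, {x | x ∈ G.verts C ∧ G.IsIntersectionVertex T {P} x} = {v} := by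
      rcases huniq hs hC with rfl | rfl
      · refine ⟨a, ?_⟩
        ext x
        simp only [hint, Set.mem_ofPred_eq, Set.mem_singleton_iff]
        constructor
        · rintro ⟨hx, rfl | rfl⟩
          · rfl
          · exact absurd hb₁ (hdis hx)
        · rintro rfl
          exact ⟨ha₁, Or.inl rfl⟩
      · refine ⟨b, ?_⟩
        ext x
        simp only [hint, Set.mem_ofPred_eq, Set.mem_singleton_iff]
        constructor
        · rintro ⟨hx, rfl | rfl⟩
          · exact absurd hx (hdis ha₁)
          · rfl
        · rintro rfl
          exact ⟨hb₁, Or.inr rfl⟩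
    obtain ⟨v, hset⟩ := hset
    rw [hset]
    refine ⟨fun hbal => ?_, fun _ => by simp⟩
    rcases huniq hs hC with rfl | rfl
    · exact absurd hbal h₁.2
    · exact absurd hbal h₂.2

theorem IsTyped.isEulerianCycleTree (h : G.IsTyped T) : G.IsEulerianCycleTree T := by
  rcases h with h | h | h
  · exact h.isEulerianCycleTree
  · exact h.isEulerianCycleTree
  · exact h.isEulerianCycleTree

/-- Every Eulerian cycle-tree contains an edge set of one of the three types. -/
theorem IsEulerianCycleTree.exists_isTyped (h : G.IsEulerianCycleTree T) :
    ∃ X ⊆ T, G.IsTyped X := by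
  obtain ⟨Ps, hT, hE⟩ := h
  by_cases hbal : ∃ C ⊆ T, G.IsCycle C ∧ G.IsBalanced C
  · obtain ⟨C, hs, hC, hb⟩ := hbal
    exact ⟨C, hs, Or.inl ⟨hC, hb⟩⟩
  have hunb : ∀ {C}, C ⊆ T → G.IsCycle C → G.IsUnbalancedCycle C :=
    fun hs hC => ⟨hC, fun hb => hbal ⟨_, hs, hC, hb⟩⟩
  have hmeet : ∀ {C C' x}, C ⊆ T → C' ⊆ T → G.IsCycle C → G.IsCycle C' → C ≠ C' →
      x ∈ G.verts C → x ∈ G.verts C' → ∃ X ⊆ T, G.IsTyped X := by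
    intro C C' x hs hs' hC hC' hne hx hx'
    refine ⟨C ∪ C', Finset.union_subset hs hs', Or.inr (Or.inl ⟨C, C', hunb hs hC, hunb hs' hC',
      hT.cycles_disjoint C C' hs hs' hC hC' hne, ⟨x, ?_⟩, rfl⟩)⟩
    exact (hT.cycles_inter C C' hs hs' hC hC' hne).eq_singleton_of_mem ⟨hx, hx'⟩
  have hcyc : ∃ C ⊆ T, G.IsCycle C := by
    obtain ⟨e, he⟩ := hT.connected.1
    rcases (hT.cover e).1 he with ⟨C, hs, hC, -⟩ | ⟨P, hP, -⟩
    · exact ⟨C, hs, hC⟩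
    · obtain ⟨a, b, -, C, C', hs, -, hC, -⟩ := hT.paths_inter P hP
      exact ⟨C, hs, hC⟩
  obtain ⟨C, hs, hC⟩ := hcyc
  -- Parity is needed only for this: an odd number is not zero, so an intersection vertex exists.
  have hodd := (hE C hs hC).2 (hunb hs hC).2
  have hne : {v | v ∈ G.verts C ∧ G.IsIntersectionVertex T Ps v}.Nonempty := by
    rw [Set.nonempty_iff_ne_empty]
    intro h0
    rw [h0, Set.ncard_empty] at hodd
    exact absurd hodd (by decide)
  obtain ⟨v, -, ⟨D, D', hs, hs', hD, hD', hne, hv, hv'⟩ | ⟨-, P, hP, -⟩⟩ := hne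
  · exact hmeet hs hs' hD hD' hne hv hv'
  · obtain ⟨a, b, hab, C₁, C₂, hs₁, hs₂, h₁, h₂, hne, ha, hb, -⟩ := hT.paths_inter P hP
    by_cases hd : Disjoint (G.verts C₁) (G.verts C₂)
    · refine ⟨C₁ ∪ P ∪ C₂, ?_, Or.inr (Or.inr ⟨C₁, C₂, P, a, b, hunb hs₁ h₁, hunb hs₂ h₂, hd, hab,
        ha, hb, rfl⟩)⟩
      refine Finset.union_subset (Finset.union_subset hs₁ fun e he => ?_) hs₂
      exact (hT.cover e).2 (Or.inr ⟨P, hP, he⟩)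
    · obtain ⟨x, hx, hx'⟩ := Set.not_disjoint_iff.1 hd
      exact hmeet hs₁ hs₂ h₁ h₂ hne hx hx'

end

section

variable [DecidableEq V] [DecidableEq E] [Fintype E] {ε : G.Orientation}

/-! ### Boundaries and flows along walks -/

/-- The net flow of `f` at the vertex `v`. -/
def boundary (G : SignedGraph V E) (ε : G.Orientation) (f : E → ℤ) (v : V) : ℤ :=
  ∑ e, G.incidence ε v e * f e

omit [DecidableEq E] in
-- Darts enumerate half-edges, so a loop at `v` contributes both of its ends.
theorem boundary_eq_sum (f : E → ℤ) (v : V) :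
    G.boundary ε f v =
      ∑ d : E × Bool, if G.dtail d = v then (ε.arrow d.1 d.2 : ℤ) * f d.1 else 0 := by
  rw [boundary, Fintype.sum_prod_type]
  refine Finset.sum_congr rfl fun e _ => ?_
  rw [incidence, Finset.sum_mul]
  refine Finset.sum_congr rfl fun b _ => ?_
  rw [ite_mul, zero_mul]
  rfl

omit [DecidableEq E] in
theorem boundary_zero (v : V) : G.boundary ε 0 v = 0 := by
  simp [boundary]

omit [DecidableEq E] in
theorem boundary_add (f g : E → ℤ) (v : V) :
    G.boundary ε (f + g) v = G.boundary ε f v + G.boundary ε g v := by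
  simp [boundary, mul_add, Finset.sum_add_distrib]

omit [DecidableEq E] in
theorem boundary_smul (c : ℤ) (f : E → ℤ) (v : V) :
    G.boundary ε (c • f) v = c * G.boundary ε f v := by
  simp only [boundary, Pi.smul_apply, smul_eq_mul, Finset.mul_sum]
  exact Finset.sum_congr rfl fun e _ => by ring

omit [DecidableEq E] in
theorem boundary_sub (f g : E → ℤ) (v : V) :
    G.boundary ε (f - g) v = G.boundary ε f v - G.boundary ε g v := by
  simp [boundary, mul_sub, Finset.sum_sub_distrib]

omit [DecidableEq V] [DecidableEq E] [Fintype E] in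
theorem arrow_not (e : E) (b : Bool) : ε.arrow e (!b) = -(G.sign e * ε.arrow e b) := by
  have h := ε.arrow_mul e
  have h' : ε.arrow e b * ε.arrow e (!b) = -G.sign e := by
    cases b
    · exact h
    · rw [mul_comm]
      exact h
  rw [← neg_mul, ← h', mul_right_comm, Int.units_mul_self, one_mul]

theorem boundary_single (d : E × Bool) (c : ℤ) (v : V) :
    G.boundary ε (Pi.single d.1 c) v = (if G.dtail d = v then (ε.arrow d.1 d.2 : ℤ) * c else 0) -
      if G.dhead d = v then (G.sign d.1 * ε.arrow d.1 d.2 : ℤ) * c else 0 := by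
  have h1 : G.boundary ε (Pi.single d.1 c) v = G.incidence ε v d.1 * c := by
    rw [boundary, Finset.sum_eq_single d.1]
    · simp
    · intro e _ he
      simp [he]
    · simp
  have h2 : G.incidence ε v d.1 = (if G.dtail d = v then (ε.arrow d.1 d.2 : ℤ) else 0) +
      if G.dhead d = v then (ε.arrow d.1 (!d.2) : ℤ) else 0 := by
    rcases d with ⟨e, b⟩
    simp only [incidence, Fintype.sum_bool, dtail, dhead]
    cases b
    · rw [add_comm]
      rfl
    · rfl
  rw [h1, h2, arrow_not]
  push_cast
  split_ifs <;> ring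

/-- The sign of a list of darts. -/
def dsign (G : SignedGraph V E) (l : List (E × Bool)) : ℤˣ := (l.map fun d => G.sign d.1).prod

/-- The function that carries one unit along a walk, with arrow `α` at the start. -/
def walkFlow (ε : G.Orientation) : ℤˣ → List (E × Bool) → E → ℤ
  | _, [] => 0
  | α, d :: l => Pi.single d.1 ((α * ε.arrow d.1 d.2 : ℤˣ) : ℤ) + walkFlow ε (α * G.sign d.1) l

/-- The contributions telescope: each arrival cancels the next departure, and the arrow is
multiplied by the sign of each edge passed. A closed walk therefore leaves `α * (1 - G.dsign l)` at
its base. -/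
theorem boundary_walkFlow {l : List (E × Bool)} {u w : V} (h : G.IsDartWalk u l w) (α : ℤˣ)
    (v : V) : G.boundary ε (walkFlow ε α l) v =
      (if u = v then (α : ℤ) else 0) - if w = v then ((α * G.dsign l : ℤˣ) : ℤ) else 0 := by
  induction l generalizing u α with
  | nil =>
    obtain rfl : u = w := h
    simp [walkFlow, boundary_zero, dsign]
  | cons d l ih =>
    obtain ⟨rfl, h⟩ := h
    rw [walkFlow, boundary_add, ih h, boundary_single]
    have hs : ((ε.arrow d.1 d.2 : ℤ)) * ε.arrow d.1 d.2 = 1 := by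
      rw [← Units.val_mul, Int.units_mul_self, Units.val_one]
    have h1 : (ε.arrow d.1 d.2 : ℤ) * ((α * ε.arrow d.1 d.2 : ℤˣ) : ℤ) = α := by
      push_cast
      linear_combination (α : ℤ) * hs
    have h2 : (G.sign d.1 * ε.arrow d.1 d.2 : ℤ) * ((α * ε.arrow d.1 d.2 : ℤˣ) : ℤ) =
        ((α * G.sign d.1 : ℤˣ) : ℤ) := by
      push_cast
      linear_combination (α * G.sign d.1 : ℤ) * hs
    have h3 : α * G.sign d.1 * G.dsign l = α * G.dsign (d :: l) := by
      simp [dsign, mul_assoc]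
    rw [h1, h2, h3]
    ring

omit [DecidableEq V] [Fintype E] in
theorem walkFlow_of_notMem {l : List (E × Bool)} {e : E} (he : e ∉ dedges l) (α : ℤˣ) :
    walkFlow ε α l e = 0 := by
  induction l generalizing α with
  | nil => rfl
  | cons d l ih =>
    simp only [dedges, List.map_cons, List.toFinset_cons, Finset.mem_insert, not_or] at he
    rw [walkFlow, Pi.add_apply, ih he.2, Pi.single_eq_of_ne he.1, add_zero]

omit [DecidableEq V] [Fintype E] in
-- An edge traversed only once receives the value ±1, with nothing to cancel it.
theorem walkFlow_ne_zero {l : List (E × Bool)} {e : E} (hl : (l.map Prod.fst).Nodup)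
    (he : e ∈ dedges l) (α : ℤˣ) : walkFlow ε α l e ≠ 0 := by
  induction l generalizing α with
  | nil => simp [dedges] at he
  | cons d l ih =>
    rw [List.map_cons, List.nodup_cons] at hl
    simp only [dedges, List.map_cons, List.toFinset_cons, Finset.mem_insert] at he
    rw [walkFlow, Pi.add_apply]
    by_cases hd : e = d.1
    · subst hd
      rw [Pi.single_eq_same, walkFlow_of_notMem (by simpa [dedges] using hl.1), add_zero]
      exact Units.ne_zero _
    · rw [Pi.single_eq_of_ne hd, zero_add]
      exact ih hl.2 (he.resolve_left hd) _

omit [DecidableEq V] [Fintype E] in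
theorem walkFlow_eq_zero_iff {l : List (E × Bool)} {e : E} (hl : (l.map Prod.fst).Nodup)
    (α : ℤˣ) : walkFlow ε α l e = 0 ↔ e ∉ dedges l :=
  ⟨fun h he => walkFlow_ne_zero hl he α h, fun he => walkFlow_of_notMem he α⟩

omit [DecidableEq V] [Fintype E] in
theorem isBalanced_dedges {l : List (E × Bool)} (hl : (l.map Prod.fst).Nodup) :
    G.IsBalanced (dedges l) ↔ G.dsign l = 1 := by
  rw [IsBalanced, dedges, List.prod_toFinset _ hl, dsign, List.map_map]
  rfl

omit [DecidableEq V] [Fintype E] in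
theorem dsign_eq_neg_one {l : List (E × Bool)} (hl : (l.map Prod.fst).Nodup)
    (h : ¬ G.IsBalanced (dedges l)) : G.dsign l = -1 :=
  (Int.units_eq_one_or _).resolve_left fun h' => h ((isBalanced_dedges hl).2 h')

/-! ### Supports of flows -/

omit [DecidableEq E] in
theorem mem_flowSupp {f : E → ℤ} {e : E} : e ∈ flowSupp f ↔ f e ≠ 0 := by
  simp [flowSupp]

omit [DecidableEq E] in
theorem flowSupp_nonempty {f : E → ℤ} : (flowSupp f).Nonempty ↔ f ≠ 0 := by
  rw [Function.ne_iff]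
  exact exists_congr fun e => mem_flowSupp

/-- A function without net flow at `v` does not have exactly one end of its support at `v`. -/
theorem exists_ne_dart_of_boundary_eq_zero {f : E → ℤ} {d : E × Bool} (hd : f d.1 ≠ 0)
    (h : G.boundary ε f (G.dtail d) = 0) :
    ∃ d', d' ≠ d ∧ f d'.1 ≠ 0 ∧ G.dtail d' = G.dtail d := by
  by_contra hcon
  push Not at hcon
  rw [boundary_eq_sum, Finset.sum_eq_single d] at h
  · rw [if_pos rfl] at h
    exact mul_ne_zero (Units.ne_zero _) hd h
  · intro d' _ hne
    by_cases h0 : f d'.1 = 0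
    · simp [h0]
    · rw [if_neg (hcon d' hne h0)]
  · simp

theorem IsFlow.leafless {f : E → ℤ} (hf : G.IsFlow ε f) : G.Leafless (flowSupp f) := by
  intro d hd
  rw [mem_flowSupp] at hd
  obtain ⟨d', h1, h2, h3⟩ := exists_ne_dart_of_boundary_eq_zero hd (hf _)
  exact ⟨d', h1, mem_flowSupp.2 h2, h3⟩

theorem IsTypeI.exists_isFlow {T : Finset E} (h : G.IsTypeI T) (ε : G.Orientation) :
    ∃ f, G.IsFlow ε f ∧ flowSupp f = T := by
  obtain ⟨hC, hb⟩ := h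
  obtain ⟨u, l, hl, rfl⟩ := isCycle_iff.1 hC
  rw [isBalanced_dedges hl.edges] at hb
  refine ⟨walkFlow ε 1 l, fun v => ?_, ?_⟩
  · exact (boundary_walkFlow hl.walk 1 v).trans (by rw [hb, mul_one, sub_self])
  · ext e
    rw [mem_flowSupp, ne_eq, walkFlow_eq_zero_iff hl.edges, not_not]

/-- Round a closed walk of sign -1 the unit comes back reversed, leaving `α - (-α)` at the base,
which may be any vertex of the cycle. -/
theorem IsUnbalancedCycle.exists_walk {C : Finset E} {v : V} (hC : G.IsUnbalancedCycle C)
    (hv : v ∈ G.verts C) (ε : G.Orientation) :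
    ∃ l, G.IsDartCycle v l ∧ dedges l = C ∧ G.dsign l = -1 ∧ ∀ (α : ℤˣ) x,
      G.boundary ε (walkFlow ε α l) x = if v = x then 2 * (α : ℤ) else 0 := by
  obtain ⟨l, hl, rfl⟩ := hC.1.exists_dartCycle hv
  have hs := dsign_eq_neg_one hl.edges hC.2
  refine ⟨l, hl, rfl, hs, fun α x => ?_⟩
  rw [boundary_walkFlow hl.walk, hs]
  split_ifs
  · push_cast
    ring
  · simp

theorem IsTypeII.exists_isFlow {T : Finset E} (h : G.IsTypeII T) (ε : G.Orientation) :
    ∃ f, G.IsFlow ε f ∧ flowSupp f = T := by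
  obtain ⟨C₁, C₂, h₁, h₂, hd, ⟨v, hv⟩, rfl⟩ := h
  obtain ⟨l₁, hl₁, rfl, -, hb₁⟩ := h₁.exists_walk (mem_of_inter_eq hv).1 ε
  obtain ⟨l₂, hl₂, rfl, -, hb₂⟩ := h₂.exists_walk (mem_of_inter_eq hv).2 ε
  refine ⟨walkFlow ε 1 l₁ - walkFlow ε 1 l₂, fun x => ?_, ?_⟩
  · exact (boundary_sub _ _ x).trans (by rw [hb₁, hb₂, sub_self])
  · ext e
    rw [mem_flowSupp, Pi.sub_apply, Finset.mem_union]
    by_cases he : e ∈ dedges l₁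
    · rw [walkFlow_of_notMem (Finset.disjoint_left.1 hd he), sub_zero]
      simp [he, walkFlow_ne_zero hl₁.edges he]
    · rw [walkFlow_of_notMem he, zero_sub, neg_ne_zero, ne_eq, walkFlow_eq_zero_iff hl₂.edges]
      simp [he]

theorem IsTypeIII.exists_isFlow {T : Finset E} (h : G.IsTypeIII T) (ε : G.Orientation) :
    ∃ f, G.IsFlow ε f ∧ flowSupp f = T := by
  obtain ⟨C₁, C₂, P, a, b, h₁, h₂, hd, hP, ha, hb, rfl⟩ := h
  have hd₁ := hP.disjoint ha
  have hd₂ := hP.disjoint hb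
  have hd₃ := disjoint_of_disjoint_verts hd
  obtain ⟨l₁, hl₁, rfl, -, hb₁⟩ := h₁.exists_walk (mem_of_inter_eq ha).1 ε
  obtain ⟨l₂, hl₂, rfl, -, hb₂⟩ := h₂.exists_walk (mem_of_inter_eq hb).1 ε
  obtain ⟨p, hp, rfl⟩ := isPath_iff.1 hP
  -- The first cycle leaves 2 at `a`. Two units along the path move it to `b`, where it becomes `2 *
  -- G.dsign p`; the second cycle, started with arrow `G.dsign p`, absorbs exactly this.
  refine ⟨walkFlow ε 1 l₁ - (2 : ℤ) • walkFlow ε 1 p - walkFlow ε (G.dsign p) l₂,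
    fun x => ?_, ?_⟩
  · refine (boundary_sub _ _ x).trans ?_
    rw [boundary_sub, boundary_smul, hb₁, hb₂, boundary_walkFlow hp.walk]
    split_ifs <;> push_cast <;> ring
  · ext e
    simp only [mem_flowSupp, Pi.sub_apply, Pi.smul_apply, smul_eq_mul, Finset.mem_union]
    by_cases he₁ : e ∈ dedges l₁
    · rw [walkFlow_of_notMem (Finset.disjoint_left.1 hd₁ he₁),
        walkFlow_of_notMem (Finset.disjoint_left.1 hd₃ he₁)]
      simp [he₁, walkFlow_ne_zero hl₁.edges he₁]
    · by_cases he₂ : e ∈ dedges l₂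
      · rw [walkFlow_of_notMem he₁, walkFlow_of_notMem (Finset.disjoint_left.1 hd₂ he₂)]
        simp [he₂, walkFlow_ne_zero hl₂.edges he₂]
      · rw [walkFlow_of_notMem he₁, walkFlow_of_notMem he₂]
        simp [he₁, he₂, walkFlow_eq_zero_iff hp.edges]

theorem IsTyped.exists_isFlow {T : Finset E} (h : G.IsTyped T) (ε : G.Orientation) :
    ∃ f, G.IsFlow ε f ∧ flowSupp f = T := by
  rcases h with h | h | h
  · exact h.exists_isFlow ε
  · exact h.exists_isFlow ε
  · exact h.exists_isFlow ε

/-- The unit flow `w` round `C` has boundary zero except for 2 at `v`. The combination of `g` and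
`w` that vanishes at one edge `e` is conserved off `v`, hence vanishes on all of `C`. Comparing
boundaries at `v` gives `g e = 0`, and then `g = 0`. -/
theorem IsUnbalancedCycle.eq_zero_of_isFlow {C : Finset E} (hC : G.IsUnbalancedCycle C)
    {g : E → ℤ} (hg : G.IsFlow ε g) (hgC : ∀ e, e ∉ C → g e = 0) : g = 0 := by
  obtain ⟨v, hv⟩ := verts_nonempty (G := G) hC.1.nonempty
  obtain ⟨l, hl, rfl, -, hb⟩ := hC.exists_walk hv ε
  set w := walkFlow ε 1 l with hw
  obtain ⟨e, he⟩ := dedges_nonempty hl.ne_nil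
  have hwe : w e ≠ 0 := walkFlow_ne_zero hl.edges he 1
  set h : E → ℤ := w e • g - g e • w with hh
  have hbh : ∀ x, x ≠ v → G.boundary ε h x = 0 := by
    intro x hx
    rw [hh, boundary_sub, boundary_smul, boundary_smul, hb, if_neg hx.symm,
      show G.boundary ε g x = 0 from hg x]
    simp
  have hsub : flowSupp h ⊆ dedges l := by
    intro e' he'
    rw [mem_flowSupp] at he'
    by_contra hn
    refine he' ?_
    simp [hh, hgC e' hn, hw, walkFlow_of_notMem hn]
  have h0 : h = 0 := by
    by_contra hne
    obtain ⟨e', he'⟩ := flowSupp_nonempty.2 hne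
    have := cycle_subset_of_leafless (T := dedges l) (X := flowSupp h) (v := v) (G := G)
      (fun d hd hdv => by
        obtain ⟨d', h1, h2, h3⟩ := exists_ne_dart_of_boundary_eq_zero (mem_flowSupp.1 hd)
          (hbh _ hdv)
        exact ⟨d', h1, mem_flowSupp.2 h2, h3⟩) hsub hC.1 hv (fun d h _ _ => h) he' (hsub he') he
    rw [mem_flowSupp] at this
    refine this ?_
    simp [hh, mul_comm]
  have hge : g e = 0 := by
    have h1 : G.boundary ε h v = 0 := by rw [h0, boundary_zero]
    rw [hh, boundary_sub, boundary_smul, boundary_smul, hb, if_pos rfl,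
      show G.boundary ε g v = 0 from hg v] at h1
    simpa using h1
  funext e'
  have h2 := congrFun h0 e'
  simp only [hh, hge, Pi.sub_apply, Pi.smul_apply, smul_eq_mul, zero_mul, sub_zero,
    Pi.zero_apply] at h2
  exact (mul_eq_zero.1 h2).resolve_left hwe

end

/-! ### Every flow support contains an edge set of one of the three types -/

/-- In a leafless edge set, a walk can be continued without backtracking until it returns to a
vertex of `K` or to one of its own vertices. -/
theorem Leafless.exists_walk [Finite V] {S : Finset E} (hS : G.Leafless S) (K : Set V)
    {d₀ : E × Bool} (h₀ : d₀.1 ∈ S) :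
    ∃ l w, (d₀ :: l).IsChain (fun d d' => G.dhead d = G.dtail d' ∧ d' ≠ dflip d) ∧
      (∀ d ∈ d₀ :: l, d.1 ∈ S) ∧ ((d₀ :: l).map G.dtail).Nodup ∧ (∀ d ∈ l, G.dtail d ∉ K) ∧
      G.IsDartWalk (G.dtail d₀) (d₀ :: l) w ∧ (w ∈ K ∨ w ∈ (d₀ :: l).map G.dtail) := by
  have := Fintype.ofFinite V
  -- Otherwise the walk could be prolonged forever, while its departure vertices stay distinct in a
  -- finite vertex set.
  by_contra hcon
  have key : ∀ n, ∃ l : List (E × Bool), l.length = n ∧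
      (d₀ :: l).IsChain (fun d d' => G.dhead d = G.dtail d' ∧ d' ≠ dflip d) ∧
      (∀ d ∈ d₀ :: l, d.1 ∈ S) ∧ ((d₀ :: l).map G.dtail).Nodup ∧ ∀ d ∈ l, G.dtail d ∉ K := by
    intro n
    induction n with
    | zero => exact ⟨[], rfl, by simp, by simpa using h₀, by simp, by simp⟩
    | succ n ih =>
      obtain ⟨l, hn, hc, hm, ht, hK⟩ := ih
      have hw := isDartWalk_of_isChain (G := G) (l := d₀ :: l) (by simp) (hc.imp fun _ _ h => h.1)
      set d := (d₀ :: l).getLast (by simp) with hd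
      have hnot : ¬ (G.dhead d ∈ K ∨ G.dhead d ∈ (d₀ :: l).map G.dtail) :=
        fun h => hcon ⟨l, _, hc, hm, ht, hK, hw, h⟩
      rw [not_or] at hnot
      obtain ⟨d', h1, h2, h3⟩ := hS (dflip d) (hm d (List.getLast_mem _))
      rw [dtail_dflip] at h3
      refine ⟨l ++ [d'], by simp [hn], ?_, ?_, ?_, ?_⟩
      · rw [← List.cons_append, List.isChain_append]
        refine ⟨hc, by simp, ?_⟩
        intro x hx y hy
        rw [List.getLast?_eq_some_getLast (by simp), Option.mem_some_iff] at hx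
        simp only [List.head?_cons, Option.mem_some_iff] at hy
        subst hx hy
        exact ⟨h3.symm, h1⟩
      · intro x hx
        rw [← List.cons_append, List.mem_append, List.mem_singleton] at hx
        rcases hx with hx | rfl
        · exact hm x hx
        · exact h2
      · rw [← List.cons_append, List.map_append, List.nodup_append_comm]
        simp only [List.map_cons, List.map_nil, List.singleton_append]
        rw [List.nodup_cons]
        exact ⟨by simpa [h3] using hnot.2, by simpa using ht⟩
      · intro x hx
        rw [List.mem_append, List.mem_singleton] at hx
        rcases hx with hx | rfl
        · exact hK x hx
        · rw [h3]
          exact hnot.1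
  obtain ⟨l, hn, -, -, ht, -⟩ := key (Fintype.card V)
  have := ht.length_le_card
  simp [hn] at this

/-- A walk that ends at one of its own departure vertices is a lollipop: a stem `A` followed by a
cycle `B`. -/
theorem exists_append_cycle {l : List (E × Bool)} {u w : V} (h : G.IsDartWalk u l w)
    (ht : (l.map G.dtail).Nodup) (he : (l.map Prod.fst).Nodup) (hw : w ∈ l.map G.dtail) :
    ∃ A B, l = A ++ B ∧ G.IsDartWalk u A w ∧ G.IsDartCycle w B := by
  obtain ⟨d, hd, rfl⟩ := List.mem_map.1 hw
  obtain ⟨A, B, rfl⟩ := List.append_of_mem hd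
  obtain ⟨x, h1, h2⟩ := isDartWalk_append.1 h
  obtain rfl : G.dtail d = x := h2.1
  rw [List.map_append] at ht he
  exact ⟨A, d :: B, rfl, h1, by simp, h2, (List.nodup_append.1 ht).2.1,
    (List.nodup_append.1 he).2.1⟩

section

variable [DecidableEq E] {S : Finset E}

theorem dedges_subset_iff {l : List (E × Bool)} : dedges l ⊆ S ↔ ∀ d ∈ l, d.1 ∈ S := by
  constructor
  · exact fun h d hd => h (fst_mem_dedges hd)
  · intro h e he
    obtain ⟨d, hd, rfl⟩ := mem_dedges.1 he
    exact h d hd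

theorem Leafless.exists_cycle [Finite V] (hS : G.Leafless S) (hne : S.Nonempty) :
    ∃ C ⊆ S, G.IsCycle C := by
  obtain ⟨e, he⟩ := hne
  obtain ⟨l, w, hc, hm, ht, -, hw, h⟩ := hS.exists_walk ∅ (d₀ := (e, true)) he
  obtain ⟨A, B, hAB, -, hB⟩ := exists_append_cycle hw ht (nodup_map_fst_of_isChain ht hc)
    (h.resolve_left (by simp))
  refine ⟨dedges B, dedges_subset_iff.2 fun d hd => hm d ?_, isCycle_iff.2 ⟨_, B, hB, rfl⟩⟩
  rw [hAB]
  exact List.mem_append_right _ hd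

variable [DecidableEq V] [Fintype E] {ε : G.Orientation}

/-- A path between two vertices of an unbalanced cycle forms a balanced cycle with one of the two
arcs. -/
theorem exists_isFlow_of_theta {A B Q : List (E × Bool)} {u w : V} (hA : G.IsDartWalk u A w)
    (hB : G.IsDartWalk w B u) (hQ : G.IsDartWalk u Q w) (heA : (A.map Prod.fst).Nodup)
    (heB : (B.map Prod.fst).Nodup) (heQ : (Q.map Prod.fst).Nodup)
    (hs : G.dsign (A ++ B) = -1) (hQA : Disjoint (dedges Q) (dedges A))
    (hQB : Disjoint (dedges Q) (dedges B)) (ε : G.Orientation) :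
    ∃ f, G.IsFlow ε f ∧ (flowSupp f = dedges Q ∪ dedges A ∨ flowSupp f = dedges Q ∪ dedges B) := by
  have hs' : G.dsign A * G.dsign B = -1 := by
    rw [← hs]
    simp [dsign]
  -- The arcs `A` and `B` have opposite signs, so `Q` has the sign of one of them. `A` runs parallel
  -- to `Q` and is subtracted; `B` leads back and is added.
  by_cases h : G.dsign Q = G.dsign A
  · refine ⟨walkFlow ε 1 Q - walkFlow ε 1 A, fun v => ?_, Or.inl ?_⟩
    · refine (boundary_sub _ _ v).trans ?_
      rw [boundary_walkFlow hQ, boundary_walkFlow hA, h, sub_self]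
    · ext e
      rw [mem_flowSupp, Pi.sub_apply, Finset.mem_union]
      by_cases he : e ∈ dedges Q
      · rw [walkFlow_of_notMem (Finset.disjoint_left.1 hQA he), sub_zero]
        simp [he, walkFlow_ne_zero heQ he]
      · rw [walkFlow_of_notMem he, zero_sub, neg_ne_zero, ne_eq, walkFlow_eq_zero_iff heA]
        simp [he]
  · have hQB' : G.dsign Q * G.dsign B = 1 := by
      rcases Int.units_eq_one_or (G.dsign Q) with h1 | h1 <;>
      rcases Int.units_eq_one_or (G.dsign A) with h2 | h2 <;>
      rcases Int.units_eq_one_or (G.dsign B) with h3 | h3 <;> simp_all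
    refine ⟨walkFlow ε 1 Q + walkFlow ε (G.dsign Q) B, fun v => ?_, Or.inr ?_⟩
    · refine (boundary_add _ _ v).trans ?_
      rw [boundary_walkFlow hQ, boundary_walkFlow hB, hQB', one_mul]
      ring
    · ext e
      rw [mem_flowSupp, Pi.add_apply, Finset.mem_union]
      by_cases he : e ∈ dedges Q
      · rw [walkFlow_of_notMem (Finset.disjoint_left.1 hQB he), add_zero]
        simp [he, walkFlow_ne_zero heQ he]
      · rw [walkFlow_of_notMem he, zero_add, ne_eq, walkFlow_eq_zero_iff heB]
        simp [he]

/-- An unbalanced cycle in the support of a flow meets another edge of the support. -/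
theorem IsUnbalancedCycle.exists_dart {C : Finset E} (hC : G.IsUnbalancedCycle C) {f : E → ℤ}
    (hf : G.IsFlow ε f) (hCf : C ⊆ flowSupp f) :
    ∃ d : E × Bool, d.1 ∈ flowSupp f ∧ d.1 ∉ C ∧ G.dtail d ∈ G.verts C := by
  by_contra hcon
  push Not at hcon
  -- If no other edge of the support touched `C`, the restriction of `f` to `C` would be a nonzero
  -- flow on an unbalanced cycle.
  set g : E → ℤ := fun e => if e ∈ C then f e else 0 with hg
  have hgf : G.IsFlow ε g := by
    intro v
    change G.boundary ε g v = 0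
    by_cases hv : v ∈ G.verts C
    · rw [← show G.boundary ε f v = 0 from hf v, boundary_eq_sum, boundary_eq_sum]
      refine Finset.sum_congr rfl fun d _ => ?_
      by_cases hd : G.dtail d = v
      · rw [if_pos hd, if_pos hd]
        by_cases hdC : d.1 ∈ C
        · simp [hg, hdC]
        · have : f d.1 = 0 := by
            by_contra h0
            exact hcon d (mem_flowSupp.2 h0) hdC (hd ▸ hv)
          simp [hg, this]
      · rw [if_neg hd, if_neg hd]
    · rw [boundary_eq_sum]
      refine Finset.sum_eq_zero fun d _ => ?_
      by_cases hd : G.dtail d = v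
      · have hdC : d.1 ∉ C := fun h => hv (hd ▸ dtail_mem_verts h)
        simp [hg, hdC]
      · rw [if_neg hd]
  have h0 := hC.eq_zero_of_isFlow hgf (fun e he => by simp [hg, he])
  obtain ⟨e, he⟩ := hC.1.nonempty
  have h1 := congrFun h0 e
  simp only [hg, if_pos he, Pi.zero_apply] at h1
  exact mem_flowSupp.1 (hCf he) h1

/-- Induction on the size of the support. When no cycle in it is balanced, an unbalanced cycle `C`
is left along an edge outside `C`, and the place where the continued walk first closes up decides
the case. -/
theorem IsFlow.exists_isTyped [Finite V] {f : E → ℤ} (hf : G.IsFlow ε f) (hne : f ≠ 0) :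
    ∃ X ⊆ flowSupp f, G.IsTyped X := by
  induction hn : (flowSupp f).card using Nat.strong_induction_on generalizing f with
  | _ n ih =>
  subst hn
  have hS := hf.leafless
  by_cases hbal : ∃ C ⊆ flowSupp f, G.IsCycle C ∧ G.IsBalanced C
  · obtain ⟨C, hs, hC, hb⟩ := hbal
    exact ⟨C, hs, Or.inl ⟨hC, hb⟩⟩
  have hunb : ∀ {C}, C ⊆ flowSupp f → G.IsCycle C → G.IsUnbalancedCycle C :=
    fun hs hC => ⟨hC, fun hb => hbal ⟨_, hs, hC, hb⟩⟩
  obtain ⟨C, hCS, hC⟩ := hS.exists_cycle (flowSupp_nonempty.2 hne)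
  have hCu := hunb hCS hC
  obtain ⟨d₀, hd₀, hd₀C, hdv⟩ := hCu.exists_dart hf hCS
  obtain ⟨l, w, hc, hm, ht, hK, hw, hend⟩ := hS.exists_walk (G.verts C) hd₀
  have hedge := nodup_map_fst_of_isChain ht hc
  set u := G.dtail d₀ with hu
  have hlS : dedges (d₀ :: l) ⊆ flowSupp f := dedges_subset_iff.2 hm
  have hlC : Disjoint (dedges (d₀ :: l)) C := by
    rw [Finset.disjoint_left]
    intro e he heC
    obtain ⟨d, hd, rfl⟩ := mem_dedges.1 he
    rcases List.mem_cons.1 hd with rfl | hd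
    · exact hd₀C heC
    · exact hK d hd (dtail_mem_verts heC)
  have htail : ∀ x ∈ (d₀ :: l).map G.dtail, x ∈ G.verts C → x = u := by
    intro x hx hxC
    rw [List.map_cons, List.mem_cons] at hx
    rcases hx with rfl | hx
    · rfl
    · obtain ⟨d, hd, rfl⟩ := List.mem_map.1 hx
      exact absurd hxC (hK d hd)
  by_cases hwC : w ∈ G.verts C
  · by_cases hwu : w = u
    -- The walk returns to its starting point on `C`: a second unbalanced cycle, sharing only `u`
    -- with `C`.
    · subst hwu
      have hcyc : G.IsDartCycle u (d₀ :: l) := ⟨by simp, hw, ht, hedge⟩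
      have hC' := hunb hlS (isCycle_iff.2 ⟨u, _, hcyc, rfl⟩)
      refine ⟨C ∪ dedges (d₀ :: l), Finset.union_subset hCS hlS, Or.inr (Or.inl
        ⟨C, _, hCu, hC', hlC.symm, ⟨u, ?_⟩, rfl⟩)⟩
      ext x
      rw [Set.mem_inter_iff, hcyc.mem_verts, Set.mem_singleton_iff]
      constructor
      · exact fun h => htail x h.2 h.1
      · rintro rfl
        exact ⟨hdv, hcyc.base_mem⟩
    -- The walk reaches `C` at another vertex, forming a theta graph. One of its paths can be
    -- dropped while still carrying a flow, so the support shrinks and induction applies.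
    · obtain ⟨c, hcyc, rfl⟩ := hC.exists_dartCycle hdv
      obtain ⟨A, B, rfl, hB, hA1, hB1⟩ := hcyc.exists_append hwC
      have hA : A ≠ [] := by
        rintro rfl
        exact hwu hA1.symm
      have hs := dsign_eq_neg_one hcyc.edges hCu.2
      have heAB := hcyc.edges
      rw [List.map_append] at heAB
      have heAB' := List.nodup_append.1 heAB
      have hAB : Disjoint (dedges A) (dedges B) := by
        rw [Finset.disjoint_left]
        intro e h1 h2
        exact heAB'.2.2 e (List.mem_toFinset.1 h1) e (List.mem_toFinset.1 h2) rfl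
      rw [dedges_append] at hlC hCS
      rw [Finset.disjoint_union_right] at hlC
      obtain ⟨g, hg, hgs⟩ := exists_isFlow_of_theta hA1 hB1 hw heAB'.1 heAB'.2.1 hedge hs
        hlC.1 hlC.2 ε
      have hlt : flowSupp g ⊂ flowSupp f ∧ g ≠ 0 := by
        have hgne : g ≠ 0 := by
          rw [← flowSupp_nonempty]
          have h1 := dedges_nonempty (l := d₀ :: l) (by simp)
          rcases hgs with h | h <;> rw [h] <;> exact h1.mono Finset.subset_union_left
        refine ⟨?_, hgne⟩
        rw [Finset.ssubset_iff_of_subset]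
        · rcases hgs with h | h
          · obtain ⟨e, he⟩ := dedges_nonempty hB
            refine ⟨e, hCS (Finset.mem_union_right _ he), ?_⟩
            rw [h, Finset.mem_union, not_or]
            exact ⟨Finset.disjoint_right.1 hlC.2 he, Finset.disjoint_right.1 hAB he⟩
          · obtain ⟨e, he⟩ := dedges_nonempty hA
            refine ⟨e, hCS (Finset.mem_union_left _ he), ?_⟩
            rw [h, Finset.mem_union, not_or]
            exact ⟨Finset.disjoint_right.1 hlC.1 he, Finset.disjoint_left.1 hAB he⟩
        · rcases hgs with h | h <;> rw [h]
          · exact Finset.union_subset hlS (Finset.subset_union_left.trans hCS)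
          · exact Finset.union_subset hlS (Finset.subset_union_right.trans hCS)
      obtain ⟨X, hX, hXt⟩ := ih _ (Finset.card_lt_card hlt.1) hg hlt.2 rfl
      exact ⟨X, hX.trans hlt.1.subset, hXt⟩
  -- The walk closes up on itself away from `C`: its stem joins `C` to a second unbalanced cycle,
  -- which is Type III.
  · obtain ⟨A, B, hAB, hA1, hB⟩ := exists_append_cycle hw ht hedge (hend.resolve_left hwC)
    have hA : A ≠ [] := by
      rintro rfl
      exact hwC ((show u = w from hA1) ▸ hdv)
    have ht' := ht
    rw [hAB, List.map_append] at ht'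
    obtain ⟨htA, -, htAB⟩ := List.nodup_append.1 ht'
    have hpath : G.IsDartPath u A w :=
      ⟨hA, hA1, htA, fun h => htAB _ h _ hB.base_mem rfl⟩
    have hsub : dedges A ∪ dedges B ⊆ flowSupp f := by
      rw [← dedges_append, ← hAB]
      exact hlS
    have hC' := hunb (Finset.subset_union_right.trans hsub) (isCycle_iff.2 ⟨_, B, hB, rfl⟩)
    refine ⟨C ∪ dedges A ∪ dedges B, ?_, Or.inr (Or.inr ⟨C, dedges B, dedges A, u, w, hCu, hC', ?_,
      isPath_iff.2 ⟨A, hpath, rfl⟩, ?_, ?_, rfl⟩)⟩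
    · rw [Finset.union_assoc]
      exact Finset.union_subset hCS hsub
    · rw [Set.disjoint_left]
      intro x hxC hxB
      rw [hB.mem_verts] at hxB
      have hxu := htail x (by rw [hAB, List.map_append]; exact List.mem_append_right _ hxB) hxC
      subst hxu
      refine htAB u ?_ u hxB rfl
      rw [← hA1.dtail_head hA]
      exact List.mem_map_of_mem (List.head_mem _)
    · ext x
      rw [Set.mem_inter_iff, hpath.mem_verts, Set.mem_singleton_iff]
      constructor
      · rintro ⟨hxC, hx | rfl⟩
        · exact htail x (by rw [hAB, List.map_append]; exact List.mem_append_left _ hx) hxC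
        · exact absurd hxC hwC
      · rintro rfl
        refine ⟨hdv, Or.inl ?_⟩
        rw [← hA1.dtail_head hA]
        exact List.mem_map_of_mem (List.head_mem _)
    · ext x
      rw [Set.mem_inter_iff, hpath.mem_verts, hB.mem_verts, Set.mem_singleton_iff]
      constructor
      · rintro ⟨hxB, hx | rfl⟩
        · exact absurd rfl (htAB x hx x hxB)
        · rfl
      · rintro rfl
        exact ⟨hB.base_mem, Or.inr rfl⟩

/-- The minimal supports of nonzero flows are the edge sets of the three types. -/
theorem isTyped_iff_minimal_flowSupp [Finite V] {T : Finset E} (ε : G.Orientation) :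
    G.IsTyped T ↔ (∃ f, G.IsFlow ε f ∧ f ≠ 0 ∧ flowSupp f = T) ∧
      ¬ ∃ g, G.IsFlow ε g ∧ g ≠ 0 ∧ flowSupp g ⊂ T := by
  constructor
  · intro h
    obtain ⟨f, hf, rfl⟩ := h.exists_isFlow ε
    refine ⟨⟨f, hf, flowSupp_nonempty.1 h.nonempty, rfl⟩, ?_⟩
    rintro ⟨g, hg, hne, hlt⟩
    obtain ⟨X, hXg, hX⟩ := hg.exists_isTyped hne
    obtain ⟨g', hg', rfl⟩ := hX.exists_isFlow ε
    have := h.eq_of_subset hX hg'.leafless (hXg.trans hlt.subset)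
    exact hlt.2 (this ▸ hXg)
  · rintro ⟨⟨f, hf, hne, rfl⟩, hmin⟩
    obtain ⟨X, hXf, hX⟩ := hf.exists_isTyped hne
    obtain ⟨g, hg, rfl⟩ := hX.exists_isFlow ε
    rcases hXf.eq_or_ssubset with h | h
    · rwa [← h]
    · exact absurd ⟨g, hg, flowSupp_nonempty.1 hX.nonempty, h⟩ hmin

/-- Typed sets are Eulerian cycle-trees and every Eulerian cycle-tree contains a typed set, so both
families have the same minimal members. All typed sets are minimal; the orientation serves only to
prove this through flows. -/
theorem isCircuit_iff_isTyped [Finite V] {T : Finset E} (ε : G.Orientation) :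
    G.IsCircuit T ↔ G.IsTyped T := by
  constructor
  · rintro ⟨hT, hmin⟩
    obtain ⟨X, hXT, hX⟩ := hT.exists_isTyped
    rcases hXT.eq_or_ssubset with h | h
    · rwa [← h]
    · exact absurd ⟨X, h, hX.isEulerianCycleTree⟩ hmin
  · intro hT
    refine ⟨hT.isEulerianCycleTree, ?_⟩
    rintro ⟨T', hlt, hT'⟩
    obtain ⟨X, hXT, hX⟩ := hT'.exists_isTyped
    obtain ⟨g, hg, rfl⟩ := hX.exists_isFlow ε
    exact ((isTyped_iff_minimal_flowSupp ε).1 hT).2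
      ⟨g, hg, flowSupp_nonempty.1 hX.nonempty, hXT.trans_ssubset hlt⟩

end

/-! ### Directions of walks -/

namespace Walk

/-- The arrow at the start of step `i`, relative to the arrow at the start of the walk. -/
def prefixSign (W : G.Walk) (i : Fin W.length) : ℤˣ := ∏ j ∈ Finset.Iio i, G.sign (W.edge j)

theorem prefixSign_succ (W : G.Walk) {i j : Fin W.length} (h : j.val = i.val + 1) :
    W.prefixSign j = G.sign (W.edge i) * W.prefixSign i := by
  have : Finset.Iio j = insert i (Finset.Iio i) := by
    ext k
    simp only [Finset.mem_Iio, Finset.mem_insert, Fin.lt_def, Fin.ext_iff]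
    omega
  rw [prefixSign, this, Finset.prod_insert (by simp)]
  rfl

/-- The arrow 1 at the start of the walk determines all the others; at the start of a step it is the
product of the signs passed so far. -/
instance (W : G.Walk) : Nonempty W.Direction := by
  refine ⟨⟨fun i b => if b = W.side i then W.prefixSign i
    else -(G.sign (W.edge i) * W.prefixSign i), fun i => ?_, fun i j h => ?_⟩⟩
  · rw [if_pos rfl, if_neg (by simp), mul_neg, mul_left_comm, Int.units_mul_self, mul_one]
  · rw [if_neg (by simp), if_pos rfl, W.prefixSign_succ h]
    push_cast
    ring

theorem Direction.arrow_not {W : G.Walk} (D : W.Direction) (i : Fin W.length) (b : Bool) :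
    D.arrow i (!b) = -(G.sign (W.edge i) * D.arrow i b) := by
  have h := D.arrow_mul i
  have h' : D.arrow i b * D.arrow i (!b) = -G.sign (W.edge i) := by
    by_cases hb : b = W.side i
    · rw [hb, h]
    · rw [Bool.eq_not.2 hb, Bool.not_not, mul_comm, h]
  rw [← neg_mul, ← h', mul_right_comm, Int.units_mul_self, one_mul]

theorem Direction.arrow_succ {W : G.Walk} (D : W.Direction) {i j : Fin W.length}
    (h : j.val = i.val + 1) :
    D.arrow j (W.side j) = D.arrow i (W.side i) * G.sign (W.edge i) := by
  have h1 := D.arrow_chain i j h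
  rw [D.arrow_not] at h1
  rw [← Units.val_inj]
  push_cast at h1 ⊢
  linarith

/-- A coherent assignment of arrows to half-edges that restricts to a direction makes all directions
of the walk agree on repeated edges. -/
theorem Direction.exists_eq_mul {W : G.Walk} (D : W.Direction) {a : E → Bool → ℤˣ}
    (ha : ∀ e b, a e (!b) = -(G.sign e * a e b))
    (hW : ∀ i j : Fin W.length, j.val = i.val + 1 →
      a (W.edge j) (W.side j) = a (W.edge i) (W.side i) * G.sign (W.edge i)) :
    ∃ η : ℤˣ, ∀ i b, D.arrow i b = η * a (W.edge i) b := by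
  have hside : ∀ η : ℤˣ, ∀ i, D.arrow i (W.side i) = η * a (W.edge i) (W.side i) →
      ∀ b, D.arrow i b = η * a (W.edge i) b := by
    intro η i h b
    by_cases hb : b = W.side i
    · rw [hb, h]
    · rw [Bool.eq_not.2 hb, D.arrow_not, ha, h, mul_neg, mul_left_comm]
  refine ⟨D.arrow W.first (W.side W.first) * a (W.edge W.first) (W.side W.first), fun i => ?_⟩
  refine hside _ i ?_
  obtain ⟨n, hn⟩ := i
  induction n with
  | zero =>
    change D.arrow W.first (W.side W.first) = _ * a (W.edge W.first) (W.side W.first)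
    rw [mul_assoc, Int.units_mul_self, mul_one]
  | succ n ih =>
    have h := ih (by omega)
    rw [D.arrow_succ (i := ⟨n, by omega⟩) (j := ⟨n + 1, hn⟩) rfl, h,
      hW ⟨n, by omega⟩ ⟨n + 1, hn⟩ rfl, mul_assoc]

end Walk

section

variable [DecidableEq E] {ε : G.Orientation}

/-! ### Characteristic vectors -/

/-- Unfolds the recursion into a sum over steps, the shape of `charVector`; `a i` is the arrow at
the start of step `i`. -/
theorem walkFlow_ofFn {n : ℕ} (g : Fin n → E × Bool) (a : Fin n → ℤˣ)
    (ha : ∀ i j : Fin n, j.val = i.val + 1 → a j = a i * G.sign (g i).1) (α : ℤˣ)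
    (hα : ∀ h : 0 < n, a ⟨0, h⟩ = α) :
    walkFlow ε α (List.ofFn g) =
      ∑ i, Pi.single (g i).1 ((a i * ε.arrow (g i).1 (g i).2 : ℤˣ) : ℤ) := by
  induction n generalizing α with
  | zero => simp [walkFlow]
  | succ n ih =>
    have h0 := hα (by omega)
    rw [List.ofFn_succ, walkFlow, Fin.sum_univ_succ, ← h0]
    congr 1
    refine ih (fun i => g i.succ) (fun i => a i.succ) (fun i j h => ha _ _ (by simp [h])) _ ?_
    intro h
    exact ha ⟨0, by omega⟩ ⟨1, by omega⟩ rfl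

namespace Walk

theorem charVector_eq (W : G.Walk) (ε : G.Orientation) (D : W.Direction) :
    W.charVector ε D = walkFlow ε (D.arrow W.first (W.side W.first)) W.darts := by
  rw [darts, walkFlow_ofFn _ (fun i => D.arrow i (W.side i)) (fun i j h => D.arrow_succ h) _
    (fun _ => rfl)]
  funext x
  rw [charVector, Finset.sum_apply]
  refine Finset.sum_congr rfl fun i _ => ?_
  rw [Pi.single_apply]
  by_cases h : W.edge i = x
  · rw [if_pos h, if_pos h.symm, mul_comm]
    push_cast
    rfl
  · rw [if_neg h, if_neg (Ne.symm h)]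

/-- All passages of an Eulerian walk through `x` have the same coupling with `ε`, so the terms of
the sum add up without cancellation. -/
theorem IsEulerian.natAbs_charVector {W : G.Walk} (hW : W.IsEulerian) (ε : G.Orientation)
    (D : W.Direction) (x : E) : (W.charVector ε D x).natAbs = W.edges.count x := by
  have hcount : W.edges.count x = (Finset.univ.filter fun i => W.edge i = x).card := by
    rw [edges, Multiset.count_map, Finset.card_def, Finset.filter_val]
    simp only [eq_comm]
  have key : ∃ s : ℤˣ, ∀ i, W.edge i = x →
      (ε.arrow (W.edge i) (W.side i) * D.arrow i (W.side i) : ℤ) = s := by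
    by_cases hx : ∃ i, W.edge i = x
    · obtain ⟨i₀, rfl⟩ := hx
      refine ⟨ε.arrow (W.edge i₀) (W.side i₀) * D.arrow i₀ (W.side i₀), fun i hi => ?_⟩
      have h1 := hW.2.2 D i i₀ hi
      rw [hi, h1]
      push_cast
      by_cases hb : W.side i = W.side i₀
      · rw [hb]
      -- For passages in opposite directions, both arrows change by the same factor `-G.sign`, so
      -- their product does not.
      · rw [Bool.eq_not.2 hb, D.arrow_not, SignedGraph.arrow_not]
        have h2 : (G.sign (W.edge i₀) : ℤ) * G.sign (W.edge i₀) = 1 := by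
          rw [← Units.val_mul, Int.units_mul_self, Units.val_one]
        push_cast
        linear_combination (ε.arrow (W.edge i₀) (W.side i₀) * D.arrow i₀ (W.side i₀) : ℤ) * h2
    · exact ⟨1, fun i hi => absurd ⟨i, hi⟩ hx⟩
  obtain ⟨s, hs⟩ := key
  have : W.charVector ε D x = s * (Finset.univ.filter fun i => W.edge i = x).card := by
    rw [charVector, ← Finset.sum_filter, Finset.sum_congr rfl
      (fun i hi => hs i (Finset.mem_filter.1 hi).2), Finset.sum_const, nsmul_eq_mul, mul_comm]
  rw [this, hcount, Int.natAbs_mul, Int.units_natAbs, one_mul, Int.natAbs_natCast]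

theorem count_edges_ne_zero (W : G.Walk) (x : E) : W.edges.count x ≠ 0 ↔ x ∈ W.supp := by
  rw [Multiset.count_ne_zero, edges, supp]
  simp

theorem IsEulerian.flowSupp_charVector [Fintype E] {W : G.Walk} (hW : W.IsEulerian)
    (ε : G.Orientation) (D : W.Direction) : flowSupp (W.charVector ε D) = W.supp := by
  ext x
  rw [mem_flowSupp, ← W.count_edges_ne_zero, ← hW.natAbs_charVector ε D, ne_eq, ne_eq,
    Int.natAbs_eq_zero]

theorem IsEulerian.charVector_ne_zero {W : G.Walk} (hW : W.IsEulerian)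
    (ε : G.Orientation) (D : W.Direction) : W.charVector ε D ≠ 0 := by
  intro h
  have h1 := hW.natAbs_charVector ε D (W.edge W.first)
  rw [h, Pi.zero_apply, Int.natAbs_zero] at h1
  exact (W.count_edges_ne_zero _).2 (by simp [supp]) h1.symm

theorem IsEulerian.isFlow_charVector [DecidableEq V] [Fintype E] {W : G.Walk} (hW : W.IsEulerian)
    (ε : G.Orientation) (D : W.Direction) : G.IsFlow ε (W.charVector ε D) := by
  intro v
  change G.boundary ε _ v = 0
  rw [W.charVector_eq, boundary_walkFlow W.isDartWalk_darts, show W.head W.last = _ from hW.1,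
    dsign, ← W.sign_eq, hW.2.1, mul_one, sub_self]

theorem supp_subset_of_edges_le {W W' : G.Walk} (h : W.edges ≤ W'.edges) : W.supp ⊆ W'.supp := by
  intro x hx
  rw [← count_edges_ne_zero] at hx ⊢
  have := Multiset.count_le_of_le x h
  omega

omit [DecidableEq E] in
theorem IsEulerian.exists_isMinimalEulerian {W : G.Walk} (hW : W.IsEulerian) :
    ∃ W' : G.Walk, W'.IsMinimalEulerian ∧ W'.edges ≤ W.edges := by
  induction h : W.edges using WellFoundedLT.induction generalizing W with
  | _ m ih =>
  subst h
  by_cases hmin : ∃ W' : G.Walk, W'.IsEulerian ∧ W'.edges < W.edges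
  · obtain ⟨W', hW', hlt⟩ := hmin
    obtain ⟨W'', h1, h2⟩ := ih _ hlt hW' rfl
    exact ⟨W'', h1, h2.trans hlt.le⟩
  · exact ⟨W, ⟨hW, hmin⟩, le_rfl⟩

end Walk

/-! ### Eulerian walks in the support of a flow -/

/-- The arrows `a` agree with the direction of the list of darts that starts with the arrow `α`. -/
def IsDirected (G : SignedGraph V E) (a : E → Bool → ℤˣ) : ℤˣ → List (E × Bool) → Prop
  | _, [] => True
  | α, d :: l => a d.1 d.2 = α ∧ G.IsDirected a (α * G.sign d.1) l

omit [DecidableEq E] in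
theorem isDirected_append {a : E → Bool → ℤˣ} {α : ℤˣ} {l l' : List (E × Bool)} :
    G.IsDirected a α (l ++ l') ↔ G.IsDirected a α l ∧ G.IsDirected a (α * G.dsign l) l' := by
  induction l generalizing α with
  | nil => simp [IsDirected, dsign]
  | cons d l ih =>
    simp only [List.cons_append, IsDirected, ih, and_assoc, dsign, List.map_cons, List.prod_cons,
      mul_assoc]

omit [DecidableEq E] in
theorem IsDirected.isChain {a : E → Bool → ℤˣ} {α : ℤˣ} {l : List (E × Bool)}
    (h : G.IsDirected a α l) :
    l.IsChain fun d d' => a d'.1 d'.2 = a d.1 d.2 * G.sign d.1 := by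
  induction l generalizing α with
  | nil => simp
  | cons d l ih =>
    cases l with
    | nil => simp
    | cons d' l =>
      refine List.isChain_cons_cons.2 ⟨?_, ih h.2⟩
      rw [h.1]
      exact h.2.1

/-- Every passage through `e` contributes the same sign `s e`, so only the number of passages
matters. -/
theorem walkFlow_eq_of_isDirected {a : E → Bool → ℤˣ} {s : E → ℤˣ}
    (ha : ∀ e b, a e b = s e * ε.arrow e b) {α : ℤˣ} {l : List (E × Bool)}
    (h : G.IsDirected a α l) (e : E) :
    walkFlow ε α l e = s e * (l.map Prod.fst).count e := by
  induction l generalizing α with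
  | nil => simp [walkFlow]
  | cons d l ih =>
    rw [walkFlow, Pi.add_apply, ih h.2, ← h.1, ha, mul_assoc, Int.units_mul_self, mul_one,
      List.map_cons, List.count_cons, Pi.single_apply]
    by_cases he : e = d.1
    · subst he
      simp only [if_true, beq_self_eq_true]
      push_cast
      ring
    · rw [if_neg he, if_neg (by simpa using Ne.symm he)]
      simp

omit [DecidableEq E] in
/-- A closed balanced list of darts directed by coherent arrows is an Eulerian walk. -/
theorem exists_isEulerian_of_isDirected {a : E → Bool → ℤˣ}
    (ha : ∀ e b, a e (!b) = -(G.sign e * a e b)) {α : ℤˣ} {u : V} {l : List (E × Bool)}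
    (hl : l ≠ []) (hw : G.IsDartWalk u l u) (hs : G.dsign l = 1) (h : G.IsDirected a α l) :
    ∃ W : G.Walk, W.IsEulerian ∧ W.edges = (l.map Prod.fst : List E) := by
  have hd := Walk.darts_ofDarts (G := G) l hl hw.isChain
  set W := Walk.ofDarts (G := G) l hl hw.isChain
  have hW := W.isDartWalk_darts
  refine ⟨W, ⟨?_, ?_, ?_⟩, by rw [W.edges_eq, hd]⟩
  · have h1 := hW.dtail_head W.darts_ne_nil
    have h2 := hW.dhead_getLast W.darts_ne_nil
    simp only [hd] at h1 h2
    rw [Walk.IsClosed, ← h1, ← h2, hw.dtail_head hl, hw.dhead_getLast hl]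
  · rw [W.sign_eq, hd]
    exact hs
  · intro D i j hij
    have hc := h.isChain
    rw [← hd, List.isChain_iff_getElem] at hc
    obtain ⟨η, hη⟩ := D.exists_eq_mul ha (by
      intro i j hij
      have := hc i.val (by simp [Walk.darts]; omega)
      simp only [Walk.darts, List.getElem_ofFn] at this
      have hj : j = ⟨i.val + 1, by omega⟩ := Fin.ext hij
      rw [hj]
      exact this)
    funext b
    rw [hη, hη, hij]

variable [DecidableEq V] [Fintype E]

/-- A nonzero flow contains an Eulerian walk. -/
theorem IsFlow.exists_isEulerian {f : E → ℤ} (hf : G.IsFlow ε f) (hne : f ≠ 0) :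
    ∃ W : G.Walk, W.IsEulerian ∧ ∀ e, W.edges.count e ≤ (f e).natAbs := by
  set s : E → ℤˣ := fun e => if 0 ≤ f e then 1 else -1 with hs
  have hsf : ∀ e, f e = s e * ((f e).natAbs : ℤ) := by
    intro e
    by_cases h : 0 ≤ f e
    · simp only [hs, if_pos h, Units.val_one, one_mul]
      omega
    · simp only [hs, if_neg h, Units.val_neg, Units.val_one, neg_mul, one_mul]
      omega
  -- Edges with negative value are reoriented, so that with the arrows `a` the flow becomes its
  -- absolute value.
  set a : E → Bool → ℤˣ := fun e b => s e * ε.arrow e b with ha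
  have ha' : ∀ e b, a e (!b) = -(G.sign e * a e b) := by
    intro e b
    rw [ha]
    simp only [arrow_not]
    rw [mul_neg, mul_left_comm]
  obtain ⟨e₀, he₀⟩ := Function.ne_iff.1 hne
  set d₀ : E × Bool := (e₀, true) with hd₀
  set u := G.dtail d₀ with hu
  set α := a d₀.1 d₀.2 with hα
  by_contra hcon
  -- If no Eulerian walk fits below the absolute value of `f`, directed walks of every length do,
  -- although their length cannot exceed the sum of the absolute values.
  have key : ∀ n, ∃ (l : List (E × Bool)) (w : V), l.length = n + 1 ∧ G.IsDartWalk u l w ∧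
      G.IsDirected a α l ∧ ∀ e, (l.map Prod.fst).count e ≤ (f e).natAbs := by
    intro n
    induction n with
    | zero =>
      refine ⟨[d₀], G.dhead d₀, rfl, ⟨rfl, rfl⟩, ⟨rfl, trivial⟩, fun e => ?_⟩
      rw [List.map_singleton, List.count_singleton]
      by_cases he : e = e₀
      · subst he
        simpa [hd₀, Nat.one_le_iff_ne_zero] using he₀
      · rw [if_neg (by simpa [hd₀] using Ne.symm he)]
        exact Nat.zero_le _
    | succ n ih =>
      obtain ⟨l, w, hn, hw, hdir, hc⟩ := ih
      have hl : l ≠ [] := by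
        rintro rfl
        simp at hn
      set β := α * G.dsign l with hβ
      have hclosed : ¬ (w = u ∧ β = α) := by
        rintro ⟨rfl, h⟩
        obtain ⟨W, hW, hWe⟩ := exists_isEulerian_of_isDirected ha' hl hw
          (mul_eq_left.1 h) hdir
        exact hcon ⟨W, hW, fun e => by rw [hWe, Multiset.coe_count]; exact hc e⟩
      set g : E → ℤ := f - walkFlow ε α l with hg
      have hge : ∀ e, g e = s e * (((f e).natAbs : ℤ) - (l.map Prod.fst).count e) := by
        intro e
        rw [hg, Pi.sub_apply, walkFlow_eq_of_isDirected (fun _ _ => rfl) hdir, mul_sub, ← hsf]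
      -- The arrow needed to leave `w` is `β`. The unused part `g` has boundary `β` at `w`, or `β -
      -- α = 2β` if `w = u`, since `β = α` there would close an Eulerian walk. So some end at `w`
      -- has arrow `β` and remaining capacity.
      have hpos : 0 < (β : ℤ) * G.boundary ε g w := by
        rw [hg, boundary_sub, boundary_walkFlow hw, show G.boundary ε f w = 0 from hf w,
          if_pos rfl, ← hβ]
        have hββ : (β : ℤ) * β = 1 := by
          rw [← Units.val_mul, Int.units_mul_self, Units.val_one]
        by_cases hwu : u = w
        · have hne : β ≠ α := fun h => hclosed ⟨hwu.symm, h⟩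
          have hβα : α = -β := by
            exact (Int.units_ne_iff_eq_neg.1 hne.symm)
          rw [if_pos hwu, hβα]
          push_cast
          linarith
        · rw [if_neg hwu]
          linarith
      rw [boundary_eq_sum, Finset.mul_sum] at hpos
      obtain ⟨d, -, hd⟩ := Finset.exists_lt_of_sum_lt (s := Finset.univ)
        (f := fun _ : E × Bool => (0 : ℤ)) (by simpa using hpos)
      by_cases hdw : G.dtail d = w
      · rw [if_pos hdw, hge] at hd
        have hk : 0 ≤ ((f d.1).natAbs : ℤ) - (l.map Prod.fst).count d.1 := by
          have := hc d.1
          omega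
        have hunit : a d.1 d.2 = β ∧
            0 < ((f d.1).natAbs : ℤ) - (l.map Prod.fst).count d.1 := by
          have heq : (β : ℤ) * (ε.arrow d.1 d.2 * (s d.1 *
              (((f d.1).natAbs : ℤ) - (l.map Prod.fst).count d.1))) =
              ((β * a d.1 d.2 : ℤˣ) : ℤ) *
              (((f d.1).natAbs : ℤ) - (l.map Prod.fst).count d.1) := by
            simp only [ha]
            push_cast
            ring
          rw [heq] at hd
          rcases Int.units_eq_one_or (β * a d.1 d.2) with h | h
          · rw [h] at hd
            refine ⟨?_, by simpa using hd⟩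
            rw [← mul_one β, ← h, ← mul_assoc, Int.units_mul_self, one_mul]
          · rw [h] at hd
            rw [Units.val_neg, Units.val_one] at hd
            linarith
        refine ⟨l ++ [d], G.dhead d, by simp [hn], isDartWalk_append.2 ⟨w, hw, hdw, rfl⟩,
          isDirected_append.2 ⟨hdir, hunit.1, trivial⟩, fun e => ?_⟩
        rw [List.map_append, List.count_append, List.map_singleton, List.count_singleton]
        have h1 := hc e
        have h2 := hunit.2
        by_cases he : e = d.1
        · subst he
          rw [if_pos (by simp)]
          omega
        · rw [if_neg (by simpa using Ne.symm he)]
          exact h1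
      · rw [if_neg hdw] at hd
        exact absurd hd (lt_irrefl _)
  obtain ⟨l, w, hn, -, -, hc⟩ := key (∑ e, (f e).natAbs)
  have h1 : ∑ e, (l.map Prod.fst).count e = l.length := by
    have := Multiset.sum_count_eq_card (s := Finset.univ)
      (m := ((l.map Prod.fst : List E) : Multiset E)) fun e _ => Finset.mem_univ e
    simpa using this
  have h2 := Finset.sum_le_sum fun e (_ : e ∈ Finset.univ) => hc e
  omega

/-- The characteristic vectors of minimal Eulerian walks are indecomposable. -/
theorem Walk.IsMinimalEulerian.isIndecomposableFlow {W : G.Walk} (hW : W.IsMinimalEulerian)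
    (ε : G.Orientation) (D : W.Direction) : G.IsIndecomposableFlow ε (W.charVector ε D) := by
  refine ⟨hW.1.isFlow_charVector ε D, hW.1.charVector_ne_zero ε D, ?_⟩
  rintro ⟨f₁, f₂, hf₁, -, hne₁, hne₂, hconf, hsum⟩
  obtain ⟨W', hW', hc⟩ := hf₁.exists_isEulerian hne₁
  -- The summands agree in sign, so absolute values add. An Eulerian walk below the absolute value
  -- of `f₁` is then properly contained in `W`, because `f₂` is nonzero.
  have habs : ∀ e, W.edges.count e = (f₁ e).natAbs + (f₂ e).natAbs := by
    intro e
    rw [← hW.1.natAbs_charVector ε D, hsum, Pi.add_apply]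
    rcases mul_nonneg_iff.1 (hconf e) with ⟨h1, h2⟩ | ⟨h1, h2⟩
    · exact Int.natAbs_add_of_nonneg h1 h2
    · exact Int.natAbs_add_of_nonpos h1 h2
  refine hW.2 ⟨W', hW', lt_of_le_of_ne ?_ ?_⟩
  · rw [Multiset.le_iff_count]
    intro e
    have h1 := hc e
    have h2 := habs e
    omega
  · intro heq
    obtain ⟨e, he⟩ := Function.ne_iff.1 hne₂
    have h1 := hc e
    have h2 := habs e
    rw [heq] at h1
    have h3 : (f₂ e).natAbs ≠ 0 := by simpa using he
    omega

/-- A walk passes to a flow of equal support by its characteristic vector; a flow passes to a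
minimal walk within its support by tracing and shrinking. -/
theorem Walk.IsMinimalEulerian.isElementary_iff {W : G.Walk} (hW : W.IsMinimalEulerian)
    (ε : G.Orientation) :
    W.IsElementary ↔ ¬ ∃ g, G.IsFlow ε g ∧ g ≠ 0 ∧ flowSupp g ⊂ W.supp := by
  rw [Walk.IsElementary, and_iff_right hW, not_iff_not]
  constructor
  · rintro ⟨W', hW', hlt⟩
    obtain ⟨D⟩ : Nonempty W'.Direction := inferInstance
    exact ⟨W'.charVector ε D, hW'.1.isFlow_charVector ε D, hW'.1.charVector_ne_zero ε D,
      by rwa [hW'.1.flowSupp_charVector]⟩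
  · rintro ⟨g, hg, hne, hlt⟩
    obtain ⟨W₁, hW₁, hc⟩ := hg.exists_isEulerian hne
    obtain ⟨W₂, hW₂, hle⟩ := hW₁.exists_isMinimalEulerian
    refine ⟨W₂, hW₂, ((Walk.supp_subset_of_edges_le hle).trans fun x hx => ?_).trans_ssubset hlt⟩
    rw [← Walk.count_edges_ne_zero] at hx
    rw [mem_flowSupp]
    have := hc x
    omega

/-- Each of the three conditions says that no nonzero flow has support properly inside `W.supp`. -/
theorem Walk.IsMinimalEulerian.tfae [Finite V] {W : G.Walk} (hW : W.IsMinimalEulerian)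
    (ε : G.Orientation) (D : W.Direction) :
    [W.IsElementary, G.IsElementaryFlow ε (W.charVector ε D), G.IsCircuit W.supp].TFAE := by
  have h₁ := hW.isElementary_iff ε
  have h₂ : G.IsElementaryFlow ε (W.charVector ε D) ↔
      ¬ ∃ g, G.IsFlow ε g ∧ g ≠ 0 ∧ flowSupp g ⊂ W.supp := by
    rw [IsElementaryFlow, and_iff_right (hW.isIndecomposableFlow ε D),
      hW.1.flowSupp_charVector ε D]
  have h₃ : G.IsCircuit W.supp ↔ ¬ ∃ g, G.IsFlow ε g ∧ g ≠ 0 ∧ flowSupp g ⊂ W.supp := by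
    rw [isCircuit_iff_isTyped ε, isTyped_iff_minimal_flowSupp ε, and_iff_right]
    exact ⟨_, hW.1.isFlow_charVector ε D, hW.1.charVector_ne_zero ε D,
      hW.1.flowSupp_charVector ε D⟩
  tfae_have 1 ↔ 2 := h₁.trans h₂.symm
  tfae_have 1 ↔ 3 := h₁.trans h₃.symm
  tfae_finish

end

section

variable [DecidableEq V] [DecidableEq E] [Fintype E] {ε : G.Orientation}

/-! ### The matroid of the incidence matrix -/

/-- The column of the rational incidence matrix at the edge `e`. -/
def incidenceColumn (G : SignedGraph V E) (ε : G.Orientation) (e : E) : V → ℚ :=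
  fun v => G.incidence ε v e

theorem linearIndepOn_incidenceColumn_iff {I : Set E} :
    LinearIndepOn ℚ (G.incidenceColumn ε) I ↔
      ∀ f, G.IsFlow ε f → (flowSupp f : Set E) ⊆ I → f = 0 := by
  have hsum : ∀ (t : Finset E) (f : E → ℤ), flowSupp f ⊆ t →
      ((∑ e ∈ t, f e • G.incidenceColumn ε e = 0) ↔ G.IsFlow ε f) := by
    intro t f hft
    rw [funext_iff]
    refine forall_congr' fun v => ?_
    have h1 : ∑ e, G.incidence ε v e * f e = ∑ e ∈ t, G.incidence ε v e * f e := by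
      refine (Finset.sum_subset (Finset.subset_univ t) fun e _ he => ?_).symm
      have : f e = 0 := by
        by_contra h0
        exact he (hft (mem_flowSupp.2 h0))
      rw [this, mul_zero]
    rw [h1, Finset.sum_apply, Pi.zero_apply, ← Int.cast_inj (α := ℚ)]
    push_cast
    simp only [Pi.smul_apply, incidenceColumn, zsmul_eq_mul, mul_comm]
  -- Independence over `ℚ` equals independence over `ℤ`, and integral relations among the columns
  -- are flows.
  rw [LinearIndepOn, ← LinearIndependent.iff_fractionRing (R := ℤ), ← LinearIndepOn,
    linearIndepOn_iff']
  constructor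
  · intro h f hf hfI
    funext e
    by_contra he
    exact he (h (flowSupp f) f hfI ((hsum _ f subset_rfl).2 hf) e (mem_flowSupp.2 he))
  · intro h t g htI hg e he
    set f : E → ℤ := fun e => if e ∈ t then g e else 0 with hf
    have hft : flowSupp f ⊆ t := by
      intro e he
      by_contra hn
      exact mem_flowSupp.1 he (by simp [hf, hn])
    have h0 := h f ((hsum t f hft).1 (by
      rw [← hg]
      exact Finset.sum_congr rfl fun e he => by simp [hf, he]))
      ((Finset.coe_subset.2 hft).trans htI)
    simpa [hf, he] using congrFun h0 e

/-- The linear matroid of the columns of the incidence matrix. -/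
noncomputable def incidenceMatroid (G : SignedGraph V E) (ε : G.Orientation) : Matroid E :=
  (IndepMatroid.ofFinite (E := Set.univ) Set.finite_univ
    (fun I => LinearIndepOn ℚ (G.incidenceColumn ε) I)
    (linearIndepOn_empty _ _)
    (fun _ _ hJ hIJ => hJ.mono hIJ)
    (by
      -- If no element of `J` could be added to `I`, the span of the columns in `J` would lie in
      -- that of `I`, against the dimensions.
      intro I J hI hJ hlt
      by_contra hcon
      push Not at hcon
      have hspan : ∀ e ∈ J, G.incidenceColumn ε e ∈
          Submodule.span ℚ (G.incidenceColumn ε '' I) := by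
        intro e he
        by_cases heI : e ∈ I
        · exact Submodule.subset_span (Set.mem_image_of_mem _ heI)
        · by_contra hn
          exact hcon e he heI ((linearIndepOn_insert heI).2 ⟨hI, hn⟩)
      have hle : Submodule.span ℚ (G.incidenceColumn ε '' J) ≤
          Submodule.span ℚ (G.incidenceColumn ε '' I) := by
        rw [Submodule.span_le]
        rintro _ ⟨e, he, rfl⟩
        exact hspan e he
      have hdim : ∀ {K : Set E}, LinearIndepOn ℚ (G.incidenceColumn ε) K →
          Module.finrank ℚ (Submodule.span ℚ (G.incidenceColumn ε '' K)) = K.ncard := by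
        classical
        intro K hK
        rw [Set.image_eq_range, finrank_span_eq_card hK, ← Nat.card_eq_fintype_card,
          Nat.card_coe_set_eq]
      have hfin : FiniteDimensional ℚ (Submodule.span ℚ (G.incidenceColumn ε '' I)) :=
        FiniteDimensional.span_of_finite ℚ (Set.toFinite _)
      have := Submodule.finrank_mono hle
      rw [hdim hI, hdim hJ] at this
      omega)
    (fun _ _ => Set.subset_univ _)).matroid

omit [DecidableEq E] in
theorem incidenceMatroid_indep_iff {I : Set E} :
    (G.incidenceMatroid ε).Indep I ↔ LinearIndepOn ℚ (G.incidenceColumn ε) I := Iff.rfl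

omit [DecidableEq E] in
theorem incidenceMatroid_ground : (G.incidenceMatroid ε).E = Set.univ := rfl

theorem incidenceMatroid_dep_iff {D : Set E} :
    (G.incidenceMatroid ε).Dep D ↔ ∃ f, G.IsFlow ε f ∧ f ≠ 0 ∧ (flowSupp f : Set E) ⊆ D := by
  rw [Matroid.Dep, incidenceMatroid_indep_iff, linearIndepOn_incidenceColumn_iff,
    incidenceMatroid_ground, and_iff_left (Set.subset_univ _)]
  push Not
  refine exists_congr fun f => ?_
  tauto

theorem incidenceMatroid_isCircuit_iff {C : Finset E} :
    (G.incidenceMatroid ε).IsCircuit (C : Set E) ↔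
      (∃ f, G.IsFlow ε f ∧ f ≠ 0 ∧ flowSupp f = C) ∧
        ¬ ∃ g, G.IsFlow ε g ∧ g ≠ 0 ∧ flowSupp g ⊂ C := by
  rw [Matroid.isCircuit_iff]
  constructor
  · rintro ⟨hdep, hmin⟩
    have heq : ∀ f, G.IsFlow ε f → f ≠ 0 → flowSupp f ⊆ C → flowSupp f = C := by
      intro f hf hne hfC
      exact Finset.coe_injective
        (hmin (incidenceMatroid_dep_iff.2 ⟨f, hf, hne, subset_rfl⟩) (Finset.coe_subset.2 hfC))
    obtain ⟨f, hf, hne, hfC⟩ := incidenceMatroid_dep_iff.1 hdep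
    refine ⟨⟨f, hf, hne, heq f hf hne (Finset.coe_subset.1 hfC)⟩, ?_⟩
    rintro ⟨g, hg, hgne, hlt⟩
    exact hlt.ne (heq g hg hgne hlt.subset)
  · rintro ⟨⟨f, hf, hne, rfl⟩, hmin⟩
    refine ⟨incidenceMatroid_dep_iff.2 ⟨f, hf, hne, subset_rfl⟩, fun D hD hDf => ?_⟩
    obtain ⟨g, hg, hgne, hgD⟩ := incidenceMatroid_dep_iff.1 hD
    rcases (Finset.coe_subset.1 (hgD.trans hDf)).eq_or_ssubset with h | h
    · exact hDf.antisymm (h ▸ hgD)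
    · exact absurd ⟨g, hg, hgne, h⟩ hmin

/-- The supports of elementary flows are the minimal supports of nonzero flows. -/
theorem exists_isElementaryFlow_iff {C : Finset E} :
    (∃ f, G.IsElementaryFlow ε f ∧ flowSupp f = C) ↔
      (∃ f, G.IsFlow ε f ∧ f ≠ 0 ∧ flowSupp f = C) ∧
        ¬ ∃ g, G.IsFlow ε g ∧ g ≠ 0 ∧ flowSupp g ⊂ C := by
  constructor
  · rintro ⟨f, ⟨⟨hf, hne, -⟩, hmin⟩, rfl⟩
    exact ⟨⟨f, hf, hne, rfl⟩, hmin⟩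
  · rintro ⟨⟨f, hf, hne, rfl⟩, hmin⟩
    -- A flow `f` of minimal support may be decomposable, for instance a multiple of another flow.
    -- The characteristic vector of a minimal Eulerian walk inside it is not, and by minimality it
    -- has the same support.
    obtain ⟨W₀, hW₀, hc⟩ := hf.exists_isEulerian hne
    obtain ⟨W, hW, hle⟩ := hW₀.exists_isMinimalEulerian
    obtain ⟨D⟩ : Nonempty W.Direction := inferInstance
    have hWf : W.supp ⊆ flowSupp f := by
      refine (Walk.supp_subset_of_edges_le hle).trans fun x hx => ?_
      rw [← Walk.count_edges_ne_zero] at hx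
      rw [mem_flowSupp]
      have := hc x
      omega
    have hs := hW.1.flowSupp_charVector ε D
    have heq : W.supp = flowSupp f := by
      refine hWf.eq_or_ssubset.resolve_right fun h => hmin ?_
      exact ⟨_, hW.1.isFlow_charVector ε D, hW.1.charVector_ne_zero ε D, hs ▸ h⟩
    refine ⟨W.charVector ε D, ⟨hW.isIndecomposableFlow ε D, ?_⟩, hs.trans heq⟩
    rwa [hs, heq]

end

end SignedGraph

/-! ### Characterization and classification of circuits -/

theorem mainTheorem7 {V E : Type*} [Fintype V] [Fintype E] [DecidableEq V] [DecidableEq E]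
    (G : SignedGraph V E) (ε : G.Orientation) :
    (∀ (W : G.Walk) (D : W.Direction), W.IsMinimalEulerian →
      [W.IsElementary, G.IsElementaryFlow ε (W.charVector ε D), G.IsCircuit W.supp].TFAE) ∧
    (∀ T : Finset E, G.IsCircuit T ↔ G.IsTypeI T ∨ G.IsTypeII T ∨ G.IsTypeIII T) ∧
    (∃! M : Matroid E, G.IsSignedGraphicMatroid M) ∧
    (∀ M : Matroid E, G.IsSignedGraphicMatroid M ↔ G.IsElementaryFlowMatroid ε M) := by
  refine ⟨fun W D hW => hW.tfae ε D, fun T => SignedGraph.isCircuit_iff_isTyped ε, ?_, fun M => ?_⟩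
  · refine ⟨G.incidenceMatroid ε, ⟨SignedGraph.incidenceMatroid_ground, fun C => ?_⟩, ?_⟩
    · rw [SignedGraph.incidenceMatroid_isCircuit_iff]
      exact (SignedGraph.isTyped_iff_minimal_flowSupp ε).symm
    · rintro M ⟨hE, hM⟩
      -- A matroid is determined by its ground set and circuits; as `E` is finite, testing finite
      -- sets suffices.
      refine Matroid.ext_isCircuit hE fun C _ => ?_
      lift C to Finset E using Set.toFinite C
      rw [hM, SignedGraph.incidenceMatroid_isCircuit_iff]
      exact SignedGraph.isTyped_iff_minimal_flowSupp ε
  · refine and_congr_right fun _ => forall_congr' fun C => ?_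
    rw [SignedGraph.exists_isElementaryFlow_iff, ← SignedGraph.isTyped_iff_minimal_flowSupp]
    rfl
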